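/- Two-coloured partitions. A two-coloured partition $p$ with $k$ upper and $l$ lower points ($k,l\ge 0$) consists of colours $\omega\in\{1,*\}^k$, $\omega'\in\{1,*\}^l$ of the upper and lower points and a partition of the set of the $k+l$ points into blocks; a through-block is a block that contains both upper and lower points. Fix $N\ge 1$ and write $[n]=\{1,\dots,n\}$. A labeling of the upper (lower) row by elements of $[N]$ is valid if upper (lower) points in the same block have the same label. Let $T_0\subseteq[N]^k$ and $T_0'\subseteq[N]^l$ be the sets of invalid labelings of the rows. Enumerate the $r=N^{tb(p)}$ labelings of the $tb(p)$ through-blocks by elements of $[N]$, and for $1\le i\le r$ let $T_i\subseteq[N]^k$ and $T_i'\subseteq[N]^l$ be the sets of valid labelings of the upper and the lower row whose values on the through-blocks are given by the $i$-th of them. Relations. For an $N\times N$ matrix $u=(u_{ij})$ let $R^{Gr}_p(u)$ be the relations (i) $\sum_{t\in T_i}u_{t_1\gamma_1}^{\omega_1}\cdots u_{t_k\gamma_k}^{\omega_k}=\sum_{t'\in T'_j}u_{\gamma'_1t'_1}^{\omega'_1}\cdots u_{\gamma'_lt'_l}^{\omega'_l}$ for $1\le i,j\le r$, $\gamma\in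 T_j$, $\gamma'\in T'_i$; (ii) $\sum_{t\in T_i}u_{t_1\gamma_1}^{\omega_1}\cdots u_{t_k\gamma_k}^{\omega_k}=0$ for $1\le i\le r$, $\gamma\in T_0$; (iii) $\sum_{t'\in T'_j}u_{\gamma'_1t'_1}^{\omega'_1}\cdots u_{\gamma'_lt'_l}^{\omega'_l}=0$ for $1\le j\le r$, $\gamma'\in T'_0$. For $1\le d\le N$ and an $N\times d$ matrix $x=(x_{ij})$ let $R^{Sp}_p(x)$ be the relations (i) $\sum_{t\in T_i}x_{t_1\gamma_1}^{\omega_1}\cdots x_{t_k\gamma_k}^{\omega_k}=\sum_{t'\in T'_i}x_{t'_1\gamma'_1}^{\omega'_1}\cdots x_{t'_l\gamma'_l}^{\omega'_l}$ for $1\le i,j\le r$, $\gamma\in T_j\cap[d]^k$, $\gamma'\in T'_j\cap[d]^l$; (ii) $\sum_{t\in T_i}x_{t_1\gamma_1}^{\omega_1}\cdots x_{t_k\gamma_k}^{\omega_k}=0$ for $1\le i\le r$, $\gamma\in T_0\cap[d]^k$; (iii) $\sum_{t'\in T'_i}x_{t'_1\gamma'_1}^{\omega'_1}\cdots x_{t'_l\gamma'_l}^{\omega'_l}=0$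 for $1\le i\le r$, $\gamma'\in T'_0\cap[d]^l$. Empty products are $1$. Theorem. Let $1\le d\le N$ be integers and let $\Pi$ be a set of two-coloured partitions that contains the four mixed-coloured pair partitions (two points in one block, both in the upper row or both in the lower row, with colours $1*$ or $*1$ from left to right). Let $C(G_N(\Pi))$ be the universal unital $C^*$-algebra generated by $u_{ij}$ ($1\le i,j\le N$) subject to $R^{Gr}_p(u)$ for all $p\in\Pi$, and let $C(X_{N,d}(\Pi))$ be the universal unital $C^*$-algebra generated by $x_{ij}$ ($1\le i\le N$, $1\le j\le d$) subject to $R^{Sp}_p(x)$ for all $p\in\Pi$ (both exist). Let $\otimes$ be the minimal tensor product. Then $G_N(\Pi)$ is a compact matrix quantum group: the $u_{ij}$ generate $C(G_N(\Pi))$, the matrices $(u_{ij})$ and $(u_{ij}^*)$ are invertible, and there is a unital $*$-homomorphism $\Delta\colon C(G_N(\Pi))\to C(G_N(\Pi))\otimes C(G_N(\Pi))$ with $\Delta(u_{ij})=\sum_{k=1}^N u_{ik}\otimes u_{kj}$. The $x_{ij}$ generate $C(X_{N,d}(\Pi))$, and $G_N(\Pi)$ acts on $X_{N,d}(\Pi)$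 from the left and from the right by matrix-vector actions: (i) there is exactly one unital $*$-homomorphism $\alpha\colon C(X_{N,d}(\Pi))\to C(G_N(\Pi))\otimes C(X_{N,d}(\Pi))$ with $\alpha(x_{ij})=\sum_{k=1}^N u_{ik}\otimes x_{kj}$ for all $1\le i\le N$, $1\le j\le d$; (ii) there is exactly one unital $*$-homomorphism $\beta\colon C(X_{N,d}(\Pi))\to C(G_N(\Pi))\otimes C(X_{N,d}(\Pi))$ with $\beta(x_{ij})=\sum_{k=1}^N u_{ki}\otimes x_{kj}$ for all $1\le i\le N$, $1\le j\le d$. -/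

import Mathlib

noncomputable section

open scoped TensorProduct

/-! ### C*-seminorms and their Hausdorff completions -/

/-- A C*-seminorm on a unital complex *-algebra: a submultiplicative seminorm with
`p (x* x) = p x ^ 2`. -/
structure CStarSeminorm (R : Type*) [Ring R] [StarRing R] [Algebra ℂ R] extends
    Seminorm ℂ R where
  mul_le' : ∀ x y : R, toFun (x * y) ≤ toFun x * toFun y
  star_mul_self' : ∀ x : R, toFun (star x * x) = toFun x ^ 2

namespace CStarSeminorm

variable {R : Type*} [Ring R] [StarRing R] [Algebra ℂ R]

instance : CoeFun (CStarSeminorm R) (fun _ => R → ℝ) := ⟨fun p => p.toSeminorm⟩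

variable (p : CStarSeminorm R)

theorem nonneg (x : R) : 0 ≤ p x := apply_nonneg p.toSeminorm x

theorem mul_le (x y : R) : p (x * y) ≤ p x * p y := p.mul_le' x y

theorem star_mul_self (x : R) : p (star x * x) = p x ^ 2 := p.star_mul_self' x

theorem le_star (x : R) : p x ≤ p (star x) := by
  rcases (p.nonneg x).eq_or_lt with h | h
  · rw [← h]; exact p.nonneg _
  · have h1 := p.star_mul_self x
    have h2 := p.mul_le (star x) x
    nlinarith

theorem star_eq (x : R) : p (star x) = p x :=
  le_antisymm (by simpa using p.le_star (star x)) (p.le_star x)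

theorem one_le : p 1 ≤ 1 := by
  have h := p.star_mul_self 1
  simp only [star_one, mul_one] at h
  nlinarith [p.nonneg 1]

/-- The algebra `R`, regarded as a seminormed algebra with the seminorm `p`. -/
@[nolint unusedArguments]
def Carrier (_ : CStarSeminorm R) : Type _ := R

instance : Ring p.Carrier := inferInstanceAs (Ring R)

instance : StarRing p.Carrier := inferInstanceAs (StarRing R)

instance : Algebra ℂ p.Carrier := inferInstanceAs (Algebra ℂ R)

instance [StarModule ℂ R] : StarModule ℂ p.Carrier := inferInstanceAs (StarModule ℂ R)

instance : SeminormedRing p.Carrier :=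
  { (inferInstance : Ring p.Carrier),
    p.toSeminorm.toAddGroupSeminorm.toSeminormedAddCommGroup with
    norm_mul_le := p.mul_le' }

theorem norm_carrier (x : p.Carrier) : ‖x‖ = p x := rfl

instance : NormedAlgebra ℂ p.Carrier where
  norm_smul_le c x := (map_smul_eq_mul p.toSeminorm c x).le

instance : NormedStarGroup p.Carrier where
  norm_star_le x := (p.star_eq x).le

/-- The C*-algebra obtained from `R` by dividing out the null space of `p` and completing. -/
def Completion : Type _ := UniformSpace.Completion p.Carrier

instance : NormedRing p.Completion :=
  inferInstanceAs (NormedRing (UniformSpace.Completion p.Carrier))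

instance : CompleteSpace p.Completion :=
  inferInstanceAs (CompleteSpace (UniformSpace.Completion p.Carrier))

instance : Algebra ℂ p.Completion :=
  inferInstanceAs (Algebra ℂ (UniformSpace.Completion p.Carrier))

instance : NormedSpace ℂ p.Completion :=
  inferInstanceAs (NormedSpace ℂ (UniformSpace.Completion p.Carrier))

instance : NormedAlgebra ℂ p.Completion where
  norm_smul_le c x := norm_smul_le (β := UniformSpace.Completion p.Carrier) c x

/-- The canonical map from `R` to the completion. -/
def incl (x : R) : p.Completion := ((show p.Carrier from x : p.Carrier) :
  UniformSpace.Completion p.Carrier)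

theorem norm_incl (x : R) : ‖p.incl x‖ = p x :=
  UniformSpace.Completion.norm_coe (E := p.Carrier) x

theorem denseRange_incl : DenseRange p.incl :=
  UniformSpace.Completion.denseRange_coe (α := p.Carrier)

theorem incl_mul (x y : R) : p.incl (x * y) = p.incl x * p.incl y :=
  UniformSpace.Completion.coe_mul (α := p.Carrier) x y

theorem incl_add (x y : R) : p.incl (x + y) = p.incl x + p.incl y :=
  UniformSpace.Completion.coe_add (α := p.Carrier) x y

theorem incl_one : p.incl 1 = 1 := rfl

theorem incl_zero : p.incl 0 = 0 := rfl

theorem incl_algebraMap (c : ℂ) : p.incl (algebraMap ℂ R c) = algebraMap ℂ p.Completion c := rfl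

instance : Star p.Completion where
  star := UniformSpace.Completion.map (star : p.Carrier → p.Carrier)

theorem continuous_star_completion : Continuous (star : p.Completion → p.Completion) :=
  UniformSpace.Completion.continuous_map

theorem incl_star (x : R) : p.incl (star x) = star (p.incl x) :=
  (UniformSpace.Completion.map_coe (f := (star : p.Carrier → p.Carrier))
    star_isometry.uniformContinuous x).symm

instance : StarRing p.Completion where
  star_involutive x := by
    refine p.denseRange_incl.induction_on x (isClosed_eq
      (p.continuous_star_completion.comp p.continuous_star_completion) continuous_id) fun a => ?_
    rw [← incl_star, ← incl_star, star_star]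
  star_mul x y := by
    refine p.denseRange_incl.induction_on₂ (p := fun x y => star (x * y) = star y * star x)
      (isClosed_eq (p.continuous_star_completion.comp continuous_mul)
        ((p.continuous_star_completion.comp continuous_snd).mul
          (p.continuous_star_completion.comp continuous_fst))) (fun a b => ?_) x y
    rw [← incl_mul, ← incl_star, ← incl_star, ← incl_star, ← incl_mul, star_mul]
  star_add x y := by
    refine p.denseRange_incl.induction_on₂ (p := fun x y => star (x + y) = star x + star y)
      (isClosed_eq (p.continuous_star_completion.comp continuous_add)
        ((p.continuous_star_completion.comp continuous_fst).add
          (p.continuous_star_completion.comp continuous_snd))) (fun a b => ?_) x y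
    rw [← incl_add, ← incl_star, ← incl_star, ← incl_star, ← incl_add, star_add]

instance : CStarRing p.Completion where
  norm_mul_self_le x := by
    refine p.denseRange_incl.induction_on x (isClosed_le (by fun_prop)
      ((p.continuous_star_completion.mul continuous_id).norm)) fun a => ?_
    rw [← incl_star, ← incl_mul, norm_incl, norm_incl, star_mul_self, sq]

instance [StarModule ℂ R] : StarModule ℂ p.Completion where
  star_smul c x := by
    refine p.denseRange_incl.induction_on x (isClosed_eq
      (p.continuous_star_completion.comp (continuous_const_smul c))
      ((continuous_const_smul (star c)).comp p.continuous_star_completion)) fun a => ?_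
    rw [Algebra.smul_def, Algebra.smul_def, ← incl_algebraMap, ← incl_algebraMap, ← incl_mul,
      ← incl_star, ← incl_star, ← incl_mul, ← Algebra.smul_def, ← Algebra.smul_def, star_smul]

instance [StarModule ℂ R] : CStarAlgebra p.Completion where

/-- The canonical unital *-homomorphism from `R` to the completion. -/
def inclHom : R →⋆ₐ[ℂ] p.Completion where
  toFun := p.incl
  map_one' := p.incl_one
  map_mul' := p.incl_mul
  map_zero' := p.incl_zero
  map_add' := p.incl_add
  commutes' := p.incl_algebraMap
  map_star' := p.incl_star

/-- The pointwise supremum of a pointwise bounded set of C*-seminorms. -/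
def sup (S : Set (CStarSeminorm R)) (hS : ∀ x, BddAbove (Set.range fun p : S => p.1 x)) :
    CStarSeminorm R where
  toFun x := ⨆ p : S, p.1 x
  map_zero' := by simp
  add_le' x y := Real.iSup_le (fun p => (map_add_le_add p.1.toSeminorm x y).trans
      (add_le_add (le_ciSup (hS x) p) (le_ciSup (hS y) p)))
    (add_nonneg (Real.iSup_nonneg fun p => p.1.nonneg x) (Real.iSup_nonneg fun p => p.1.nonneg y))
  neg' x := by simp
  smul' c x := by
    simp only [map_smul_eq_mul]
    rw [Real.mul_iSup_of_nonneg (norm_nonneg c)]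
  mul_le' x y := Real.iSup_le (fun p => (p.1.mul_le x y).trans
      (mul_le_mul (le_ciSup (hS x) p) (le_ciSup (hS y) p) (p.1.nonneg y)
        (Real.iSup_nonneg fun p => p.1.nonneg x)))
    (mul_nonneg (Real.iSup_nonneg fun p => p.1.nonneg x) (Real.iSup_nonneg fun p => p.1.nonneg y))
  star_mul_self' x := by
    apply le_antisymm
    · refine Real.iSup_le (fun p => ?_) (sq_nonneg _)
      rw [p.1.star_mul_self]
      exact pow_le_pow_left₀ (p.1.nonneg x) (le_ciSup (hS x) p) 2
    · have h0 : 0 ≤ ⨆ p : S, p.1 (star x * x) := Real.iSup_nonneg fun p => p.1.nonneg _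
      refine (Real.le_sqrt (Real.iSup_nonneg fun p => p.1.nonneg x) h0).1
        (Real.iSup_le (fun p => Real.le_sqrt_of_sq_le ?_) (Real.sqrt_nonneg _))
      rw [← p.1.star_mul_self]
      exact le_ciSup (hS (star x * x)) p

end CStarSeminorm

/-! ### Universal C*-algebras -/

/-- The two colours of points, white (exponent `1`) and black (exponent `*`). -/
inductive Colour
  | white
  | black

namespace Colour

/-- The other colour. -/
def flip : Colour → Colour
  | white => black
  | black => white

@[simp] theorem flip_flip (c : Colour) : c.flip.flip = c := by cases c <;> rfl

/-- The power `a ^ c`: it is `a` for the exponent `1` and `a*` for the exponent `*`. -/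
def pow {A : Type*} [Star A] (c : Colour) (a : A) : A :=
  match c with
  | white => a
  | black => star a

end Colour

/-- The free unital complex *-algebra on `E` (*-polynomials in noncommuting variables): finite
linear combinations of words in the letters `e = (e, white)` and `e* = (e, black)`. -/
def FreeStarAlgebra (E : Type*) : Type _ := MonoidAlgebra ℂ (FreeMonoid (E × Colour))

namespace FreeStarAlgebra

variable {E : Type*}

instance : Ring (FreeStarAlgebra E) :=
  inferInstanceAs (Ring (MonoidAlgebra ℂ (FreeMonoid (E × Colour))))

instance : Algebra ℂ (FreeStarAlgebra E) :=
  inferInstanceAs (Algebra ℂ (MonoidAlgebra ℂ (FreeMonoid (E × Colour))))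

/-- The scalar multiple `c w` of a word `w`. -/
def term (w : FreeMonoid (E × Colour)) (c : ℂ) : FreeStarAlgebra E := MonoidAlgebra.single w c

theorem term_mul (w v : FreeMonoid (E × Colour)) (a b : ℂ) :
    term w a * term v b = term (w * v) (a * b) := MonoidAlgebra.single_mul_single _ _ _ _

theorem smul_term (w : FreeMonoid (E × Colour)) (a b : ℂ) :
    a • term w b = term w (a * b) := MonoidAlgebra.smul_single _ _ _

theorem one_def : (1 : FreeStarAlgebra E) = term 1 1 := rfl

@[elab_as_elim]
theorem induction {motive : FreeStarAlgebra E → Prop} (f : FreeStarAlgebra E)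
    (zero : motive 0) (add : ∀ f g, motive f → motive g → motive (f + g))
    (term : ∀ w c, motive (term w c)) : motive f :=
  MonoidAlgebra.induction_linear f zero add term

/-- The adjoint of a word: reverse it and exchange `e` and `e*`. -/
def wordStar (w : FreeMonoid (E × Colour)) : FreeMonoid (E × Colour) :=
  FreeMonoid.ofList ((w.toList.map fun a => (a.1, a.2.flip)).reverse)

theorem wordStar_mul (w v : FreeMonoid (E × Colour)) :
    wordStar (w * v) = wordStar v * wordStar w := by
  simp [wordStar, FreeMonoid.toList_mul, FreeMonoid.ofList_append]

theorem wordStar_wordStar (w : FreeMonoid (E × Colour)) : wordStar (wordStar w) = w := by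
  simp [wordStar, Function.comp_def]

/-- The involution as an additive map. -/
def starHom : FreeStarAlgebra E →+ FreeStarAlgebra E :=
  (Finsupp.liftAddHom fun w : FreeMonoid (E × Colour) =>
    ({ toFun := fun c => term (wordStar w) (star c)
       map_zero' := by rw [star_zero]; exact MonoidAlgebra.single_zero _
       map_add' := fun a b => by
        rw [star_add]; exact MonoidAlgebra.single_add _ _ _ } : ℂ →+ FreeStarAlgebra E)).comp
    MonoidAlgebra.coeffAddEquiv.toAddMonoidHom

theorem starHom_term (w : FreeMonoid (E × Colour)) (c : ℂ) :
    starHom (term w c) = term (wordStar w) (star c) :=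
  Finsupp.liftAddHom_apply_single _ w c

instance : StarRing (FreeStarAlgebra E) where
  star := starHom
  star_involutive f := by
    induction f using FreeStarAlgebra.induction with
    | zero => simp
    | add f g hf hg => rw [map_add, map_add, hf, hg]
    | term w c => rw [starHom_term, starHom_term, wordStar_wordStar, star_star]
  star_add := map_add starHom
  star_mul f g := by
    change starHom (f * g) = starHom g * starHom f
    induction f using FreeStarAlgebra.induction with
    | zero => simp
    | add f₁ f₂ h₁ h₂ => rw [add_mul, map_add, map_add, h₁, h₂, mul_add]
    | term w c =>
      induction g using FreeStarAlgebra.induction with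
      | zero => simp
      | add g₁ g₂ h₁ h₂ => rw [mul_add, map_add, map_add, h₁, h₂, add_mul]
      | term v b =>
        rw [term_mul, starHom_term, starHom_term, starHom_term, term_mul, wordStar_mul, star_mul]

theorem star_term (w : FreeMonoid (E × Colour)) (c : ℂ) :
    star (term w c) = term (wordStar w) (star c) := starHom_term w c

instance : StarModule ℂ (FreeStarAlgebra E) where
  star_smul a f := by
    induction f using FreeStarAlgebra.induction with
    | zero => simp
    | add f g hf hg => rw [smul_add, star_add, hf, hg, star_add, smul_add]
    | term w c => rw [smul_term, star_term, star_term, smul_term, star_mul, mul_comm]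

/-- The free generator belonging to `e`. -/
def gen (e : E) : FreeStarAlgebra E := term (FreeMonoid.of (e, Colour.white)) 1

theorem term_of (e : E) (c : Colour) : term (FreeMonoid.of (e, c)) 1 = c.pow (gen e) := by
  cases c
  · rfl
  · change _ = star (gen e)
    rw [gen, star_term, star_one]
    rfl

end FreeStarAlgebra

/-- The C*-seminorms on the free *-algebra in which every element of `R` becomes zero. -/
def relationSeminorms {E : Type*} (R : Set (FreeStarAlgebra E)) :
    Set (CStarSeminorm (FreeStarAlgebra E)) :=
  {p | ∀ r ∈ R, p r = 0}

/-- The condition under which the universal C*-algebra exists: for every *-polynomial `f`, the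
values `p f` of the C*-seminorms which respect the relations are bounded. -/
def UniversalExists {E : Type*} (R : Set (FreeStarAlgebra E)) : Prop :=
  ∀ f, BddAbove (Set.range fun p : relationSeminorms R => p.1 f)

theorem universalExists_of_gen_le_one {E : Type*} (R : Set (FreeStarAlgebra E))
    (h : ∀ p ∈ relationSeminorms R, ∀ e, p (FreeStarAlgebra.gen e) ≤ 1) : UniversalExists R := by
  have key : ∀ p ∈ relationSeminorms R, ∀ w : FreeMonoid (E × Colour),
      p (FreeStarAlgebra.term w 1) ≤ 1 := by
    intro p hp w
    induction w using FreeMonoid.inductionOn' with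
    | one => exact p.one_le
    | of_mul a w ih =>
      have hmul : FreeStarAlgebra.term (FreeMonoid.of a * w) 1 =
          FreeStarAlgebra.term (FreeMonoid.of a) 1 * FreeStarAlgebra.term w 1 := by
        rw [FreeStarAlgebra.term_mul, one_mul]
      rw [hmul]
      refine (p.mul_le _ _).trans (mul_le_one₀ ?_ (p.nonneg _) ih)
      obtain ⟨e, c⟩ := a
      rw [FreeStarAlgebra.term_of]
      cases c
      · exact h p hp e
      · exact (p.star_eq _).trans_le (h p hp e)
  intro f
  induction f using FreeStarAlgebra.induction with
  | zero =>
    refine ⟨0, ?_⟩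
    rintro _ ⟨p, rfl⟩
    exact (map_zero p.1.toSeminorm).le
  | add f g hf hg =>
    obtain ⟨a, ha⟩ := hf
    obtain ⟨b, hb⟩ := hg
    refine ⟨a + b, ?_⟩
    rintro _ ⟨p, rfl⟩
    exact (map_add_le_add p.1.toSeminorm f g).trans (add_le_add (ha ⟨p, rfl⟩) (hb ⟨p, rfl⟩))
  | term w c =>
    refine ⟨‖c‖, ?_⟩
    rintro _ ⟨p, rfl⟩
    have hc : FreeStarAlgebra.term w c = c • FreeStarAlgebra.term w 1 := by
      rw [FreeStarAlgebra.smul_term, mul_one]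
    change p.1.toSeminorm _ ≤ _
    rw [hc, map_smul_eq_mul]
    exact mul_le_of_le_one_right (norm_nonneg c) (key p.1 p.2 w)

/-- The universal unital C*-algebra `C*(E | R)` generated by `E` subject to the relations `r = 0`
for `r ∈ R`: the completion of the free *-algebra with respect to the largest C*-seminorm that
respects the relations. -/
abbrev UniversalCStarAlgebra {E : Type*} (R : Set (FreeStarAlgebra E)) (hR : UniversalExists R) :
    Type _ :=
  (CStarSeminorm.sup (relationSeminorms R) hR).Completion

/-- The generator of `C*(E | R)` belonging to `e`. -/
def UniversalCStarAlgebra.gen {E : Type*} (R : Set (FreeStarAlgebra E)) (hR : UniversalExists R)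
    (e : E) : UniversalCStarAlgebra R hR :=
  (CStarSeminorm.sup (relationSeminorms R) hR).inclHom (FreeStarAlgebra.gen e)

/-! ### The minimal tensor product of unital C*-algebras -/

section MinTensor

universe u v

variable {A : Type u} {B : Type v} [CStarAlgebra A] [CStarAlgebra B]

section Representations

variable {H : Type u} {K : Type v} [NormedAddCommGroup H] [InnerProductSpace ℂ H] [CompleteSpace H]
  [NormedAddCommGroup K] [InnerProductSpace ℂ K] [CompleteSpace K]

/-- `a ↦ π a ⊗ 1`, by bounded operators on the algebraic tensor product `H ⊗ K` with its
inner product. -/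
def leftRep (K : Type v) [NormedAddCommGroup K] [InnerProductSpace ℂ K]
    (π : A →⋆ₐ[ℂ] (H →L[ℂ] H)) : A →ₐ[ℂ] ((H ⊗[ℂ] K) →L[ℂ] (H ⊗[ℂ] K)) :=
  AlgHom.ofLinearMap
    { toFun := fun a => (π a).rTensor K
      map_add' := fun a b => by rw [map_add, ContinuousLinearMap.rTensor_add]
      map_smul' := fun c a => by rw [map_smul, ContinuousLinearMap.rTensor_smul]; rfl }
    (by simp) (fun a b => by simp [ContinuousLinearMap.rTensor_mul])

/-- `b ↦ 1 ⊗ ρ b`, by bounded operators on the algebraic tensor product `H ⊗ K` with its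
inner product. -/
def rightRep (H : Type u) [NormedAddCommGroup H] [InnerProductSpace ℂ H]
    (ρ : B →⋆ₐ[ℂ] (K →L[ℂ] K)) : B →ₐ[ℂ] ((H ⊗[ℂ] K) →L[ℂ] (H ⊗[ℂ] K)) :=
  AlgHom.ofLinearMap
    { toFun := fun b => (ρ b).lTensor H
      map_add' := fun a b => by rw [map_add, ContinuousLinearMap.lTensor_add]
      map_smul' := fun c a => by rw [map_smul, ContinuousLinearMap.lTensor_smul]; rfl }
    (by simp) (fun a b => by simp [ContinuousLinearMap.lTensor_mul])

/-- The representation `π ⊗ ρ` of the algebraic tensor product, `a ⊗ b ↦ π a ⊗ ρ b`. The operators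
are given on the dense subspace `H ⊗ K` (algebraic) of the Hilbert space tensor product; restricting
a bounded operator to a dense subspace does not change its operator norm. -/
def tensorRep (π : A →⋆ₐ[ℂ] (H →L[ℂ] H)) (ρ : B →⋆ₐ[ℂ] (K →L[ℂ] K)) :
    A ⊗[ℂ] B →ₐ[ℂ] ((H ⊗[ℂ] K) →L[ℂ] (H ⊗[ℂ] K)) :=
  Algebra.TensorProduct.lift (leftRep K π) (rightRep H ρ) fun a b => by
    change (π a).rTensor K ∘L (ρ b).lTensor H = (ρ b).lTensor H ∘L (π a).rTensor K
    ext x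
    induction x with
    | zero => simp
    | add x y hx hy => rw [map_add, map_add, hx, hy]
    | tmul x y => simp

theorem tensorRep_tmul (π : A →⋆ₐ[ℂ] (H →L[ℂ] H)) (ρ : B →⋆ₐ[ℂ] (K →L[ℂ] K)) (a : A) (b : B)
    (x : H) (y : K) : tensorRep π ρ (a ⊗ₜ b) (x ⊗ₜ y) = π a x ⊗ₜ ρ b y := by
  rw [tensorRep, Algebra.TensorProduct.lift_tmul]
  rfl

theorem inner_tensorRep (π : A →⋆ₐ[ℂ] (H →L[ℂ] H)) (ρ : B →⋆ₐ[ℂ] (K →L[ℂ] K)) (z : A ⊗[ℂ] B)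
    (ξ η : H ⊗[ℂ] K) :
    inner ℂ (tensorRep π ρ z ξ) η = inner ℂ ξ (tensorRep π ρ (star z) η) := by
  induction z with
  | zero => simp
  | add z w hz hw =>
    rw [map_add, star_add, map_add, add_apply, add_apply,
      inner_add_left, inner_add_right, hz, hw]
  | tmul a b =>
    induction ξ with
    | zero => simp
    | add ξ ξ' h h' => rw [map_add, inner_add_left, inner_add_left, h, h']
    | tmul x y =>
      induction η with
      | zero => simp
      | add η η' h h' => rw [map_add, inner_add_right, inner_add_right, h, h']
      | tmul x' y' =>
        rw [TensorProduct.star_tmul, tensorRep_tmul, tensorRep_tmul, TensorProduct.inner_tmul,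
          TensorProduct.inner_tmul, map_star, map_star, ContinuousLinearMap.star_eq_adjoint,
          ContinuousLinearMap.star_eq_adjoint, ContinuousLinearMap.adjoint_inner_right,
          ContinuousLinearMap.adjoint_inner_right]

theorem opNorm_smul_eq {V : Type*} [NormedAddCommGroup V] [InnerProductSpace ℂ V] (c : ℂ)
    (T : V →L[ℂ] V) : ‖c • T‖ = ‖c‖ * ‖T‖ := norm_smul c T

/-- The C*-seminorm `z ↦ ‖(π ⊗ ρ) z‖` on the algebraic tensor product. -/
def spatialSeminorm (π : A →⋆ₐ[ℂ] (H →L[ℂ] H)) (ρ : B →⋆ₐ[ℂ] (K →L[ℂ] K)) :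
    CStarSeminorm (A ⊗[ℂ] B) where
  toFun z := ‖tensorRep π ρ z‖
  map_zero' := by rw [map_zero]; exact ContinuousLinearMap.opNorm_zero
  add_le' z w := by
    rw [map_add]; exact ContinuousLinearMap.opNorm_add_le (tensorRep π ρ z) (tensorRep π ρ w)
  neg' z := by rw [map_neg]; exact ContinuousLinearMap.opNorm_neg (tensorRep π ρ z)
  smul' c z := by rw [map_smul]; exact opNorm_smul_eq c (tensorRep π ρ z)
  mul_le' z w := by rw [map_mul]; exact norm_mul_le (tensorRep π ρ z) (tensorRep π ρ w)
  star_mul_self' z := by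
    have main : ∀ z : A ⊗[ℂ] B, ‖tensorRep π ρ z‖ ^ 2 ≤ ‖tensorRep π ρ (star z * z)‖ := by
      intro z
      have h0 : 0 ≤ ‖tensorRep π ρ (star z * z)‖ := ContinuousLinearMap.opNorm_nonneg _
      refine (Real.le_sqrt (ContinuousLinearMap.opNorm_nonneg _) h0).1
        (ContinuousLinearMap.opNorm_le_bound _ (Real.sqrt_nonneg _) fun ξ => ?_)
      refine (sq_le_sq₀ (norm_nonneg _) (by positivity)).1 ?_
      rw [mul_pow, Real.sq_sqrt h0, ← inner_self_eq_norm_sq (𝕜 := ℂ), inner_tensorRep]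
      refine (RCLike.re_le_norm _).trans ((norm_inner_le_norm (𝕜 := ℂ) ξ
        (tensorRep π ρ (star z) (tensorRep π ρ z ξ))).trans ?_)
      rw [← mul_apply_eq_comp, ← map_mul]
      have h := (tensorRep π ρ (star z * z)).le_opNorm ξ
      nlinarith [norm_nonneg ξ]
    have hs : ∀ z : A ⊗[ℂ] B, ‖tensorRep π ρ z‖ ≤ ‖tensorRep π ρ (star z)‖ := by
      intro z
      rcases (ContinuousLinearMap.opNorm_nonneg (tensorRep π ρ z)).eq_or_lt with h | h
      · rw [← h]; exact ContinuousLinearMap.opNorm_nonneg _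
      · have h1 := main z
        rw [map_mul] at h1
        have h2 := norm_mul_le (tensorRep π ρ (star z)) (tensorRep π ρ z)
        nlinarith
    refine le_antisymm ?_ (main z)
    have h3 := hs (star z)
    rw [star_star] at h3
    rw [map_mul, sq]
    exact (norm_mul_le (tensorRep π ρ (star z)) (tensorRep π ρ z)).trans
      (mul_le_mul_of_nonneg_right h3 (ContinuousLinearMap.opNorm_nonneg _))

theorem spatialSeminorm_apply (π : A →⋆ₐ[ℂ] (H →L[ℂ] H)) (ρ : B →⋆ₐ[ℂ] (K →L[ℂ] K))
    (z : A ⊗[ℂ] B) : spatialSeminorm π ρ z = ‖tensorRep π ρ z‖ := rfl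

end Representations

variable (A B)

/-- All the seminorms `z ↦ ‖(π ⊗ ρ) z‖`, for *-representations `π` of `A` and `ρ` of `B` on Hilbert
spaces. -/
def spatialSeminorms : Set (CStarSeminorm (A ⊗[ℂ] B)) :=
  {p | ∃ (H : Type u) (_ : NormedAddCommGroup H) (_ : InnerProductSpace ℂ H) (_ : CompleteSpace H)
    (K : Type v) (_ : NormedAddCommGroup K) (_ : InnerProductSpace ℂ K) (_ : CompleteSpace K)
    (π : A →⋆ₐ[ℂ] (H →L[ℂ] H)) (ρ : B →⋆ₐ[ℂ] (K →L[ℂ] K)), p = spatialSeminorm π ρ}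

theorem bddAbove_spatialSeminorms (z : A ⊗[ℂ] B) :
    BddAbove (Set.range fun p : spatialSeminorms A B => p.1 z) := by
  induction z with
  | zero =>
    refine ⟨0, ?_⟩
    rintro _ ⟨p, rfl⟩
    exact (map_zero p.1.toSeminorm).le
  | add z w hz hw =>
    obtain ⟨a, ha⟩ := hz
    obtain ⟨b, hb⟩ := hw
    refine ⟨a + b, ?_⟩
    rintro _ ⟨p, rfl⟩
    exact (map_add_le_add p.1.toSeminorm z w).trans (add_le_add (ha ⟨p, rfl⟩) (hb ⟨p, rfl⟩))
  | tmul a b =>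
    refine ⟨‖a‖ * ‖b‖, ?_⟩
    rintro _ ⟨⟨p, H, _, _, _, K, _, _, _, π, ρ, rfl⟩, rfl⟩
    change spatialSeminorm π ρ (a ⊗ₜ b) ≤ _
    rw [spatialSeminorm_apply, tensorRep, Algebra.TensorProduct.lift_tmul]
    refine (norm_mul_le (leftRep K π a) (rightRep H ρ b)).trans
      (mul_le_mul ?_ ?_ (ContinuousLinearMap.opNorm_nonneg _) (norm_nonneg _))
    · exact ((π a).norm_rTensor_le (G := K)).trans (NonUnitalStarAlgHom.norm_apply_le π a)
    · exact ((ρ b).norm_lTensor_le (G := H)).trans (NonUnitalStarAlgHom.norm_apply_le ρ b)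

/-- The minimal (spatial) tensor product of two unital C*-algebras. -/
abbrev MinTensor : Type (max u v) :=
  (CStarSeminorm.sup (spatialSeminorms A B) (bddAbove_spatialSeminorms A B)).Completion

variable {A B}

/-- The elementary tensor `a ⊗ b` in the minimal tensor product. -/
def MinTensor.tmul (a : A) (b : B) : MinTensor A B :=
  (CStarSeminorm.sup (spatialSeminorms A B) (bddAbove_spatialSeminorms A B)).inclHom (a ⊗ₜ b)

end MinTensor

/-! ### Two-coloured partitions and their labelings -/

/-- A two-coloured partition on `k` upper and `l` lower points: a colour for every point and a
partition of the set of all points into blocks (the classes of an equivalence relation). -/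
structure TwoColouredPartition where
  /-- The number of upper points. -/
  k : ℕ
  /-- The number of lower points. -/
  l : ℕ
  /-- The colours of the upper points, from left to right. -/
  upperColour : Fin k → Colour
  /-- The colours of the lower points, from left to right. -/
  lowerColour : Fin l → Colour
  /-- The relation "in the same block" on the upper (`inl`) and lower (`inr`) points. -/
  blocks : Setoid (Fin k ⊕ Fin l)

namespace TwoColouredPartition

/-- The pair partition without upper points, whose two lower points have the given colours. -/
def lowerPair (c₁ c₂ : Colour) : TwoColouredPartition where
  k := 0
  l := 2
  upperColour := ![]
  lowerColour := ![c₁, c₂]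
  blocks := ⊤

/-- The pair partition without lower points, whose two upper points have the given colours. -/
def upperPair (c₁ c₂ : Colour) : TwoColouredPartition where
  k := 2
  l := 0
  upperColour := ![c₁, c₂]
  lowerColour := ![]
  blocks := ⊤

/-- The four mixed-coloured pair partitions. -/
def mixedPairs : Set TwoColouredPartition :=
  {lowerPair .white .black, lowerPair .black .white,
    upperPair .white .black, upperPair .black .white}

variable (p : TwoColouredPartition)

/-- The through-blocks: the blocks that contain both upper and lower points. -/
def ThroughBlock : Type :=
  {b : Quotient p.blocks //
    (∃ a : Fin p.k, Quotient.mk p.blocks (Sum.inl a) = b) ∧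
      ∃ a : Fin p.l, Quotient.mk p.blocks (Sum.inr a) = b}

variable {N d : ℕ}

/-- A labeling of the upper row is valid if upper points in the same block have equal labels. -/
def UpperValid (t : Fin p.k → Fin N) : Prop :=
  ∀ a b : Fin p.k, p.blocks (Sum.inl a) (Sum.inl b) → t a = t b

/-- A labeling of the lower row is valid if lower points in the same block have equal labels. -/
def LowerValid (t : Fin p.l → Fin N) : Prop :=
  ∀ a b : Fin p.l, p.blocks (Sum.inr a) (Sum.inr b) → t a = t b

/-- The set `T_0` of the invalid labelings of the upper row. -/
def upperInvalid (N : ℕ) : Set (Fin p.k → Fin N) := {t | ¬ p.UpperValid t}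

/-- The set `T'_0` of the invalid labelings of the lower row. -/
def lowerInvalid (N : ℕ) : Set (Fin p.l → Fin N) := {t | ¬ p.LowerValid t}

/-- The set `T_i` of the valid labelings of the upper row with the through-block labeling `i`. The
index `i` runs through the `r = N ^ tb(p)` labelings of the through-blocks. -/
def upperClass (i : p.ThroughBlock → Fin N) : Set (Fin p.k → Fin N) :=
  {t | p.UpperValid t ∧ ∀ (a : Fin p.k) (b : p.ThroughBlock),
    Quotient.mk p.blocks (Sum.inl a) = b.1 → t a = i b}

/-- The set `T'_i` of the valid labelings of the lower row with the through-block labeling `i`. -/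
def lowerClass (i : p.ThroughBlock → Fin N) : Set (Fin p.l → Fin N) :=
  {t | p.LowerValid t ∧ ∀ (a : Fin p.l) (b : p.ThroughBlock),
    Quotient.mk p.blocks (Sum.inr a) = b.1 → t a = i b}

variable {A : Type*} [Ring A] [StarRing A]

open scoped Classical in
/-- The sum of the products `x_{t_1 γ_1}^{ω_1} ⋯ x_{t_k γ_k}^{ω_k}` over `t ∈ T_i`. -/
def upperSum (x : Matrix (Fin N) (Fin d) A) (i : p.ThroughBlock → Fin N) (γ : Fin p.k → Fin d) :
    A :=
  ∑ t : Fin p.k → Fin N with t ∈ p.upperClass i,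
    (List.ofFn fun a => (p.upperColour a).pow (x (t a) (γ a))).prod

open scoped Classical in
/-- The sum of the products `x_{t'_1 γ'_1}^{ω'_1} ⋯ x_{t'_l γ'_l}^{ω'_l}` over `t' ∈ T'_i`. -/
def lowerSum (x : Matrix (Fin N) (Fin d) A) (i : p.ThroughBlock → Fin N) (γ : Fin p.l → Fin d) :
    A :=
  ∑ t : Fin p.l → Fin N with t ∈ p.lowerClass i,
    (List.ofFn fun a => (p.lowerColour a).pow (x (t a) (γ a))).prod

/-- The quantum group relations `R^{Gr}_p(u)`, as the set of the elements that they set to zero.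
Note that `lowerSum uᵀ j γ'` is the sum of `u_{γ'_1 t'_1}^{ω'_1} ⋯ u_{γ'_l t'_l}^{ω'_l}` over
`t' ∈ T'_j`. -/
def groupRelations (u : Matrix (Fin N) (Fin N) A) : Set A :=
  {r | ∃ i j : p.ThroughBlock → Fin N, ∃ γ ∈ p.upperClass j, ∃ γ' ∈ p.lowerClass i,
      r = p.upperSum u i γ - p.lowerSum u.transpose j γ'} ∪
  {r | ∃ i : p.ThroughBlock → Fin N, ∃ γ ∈ p.upperInvalid N, r = p.upperSum u i γ} ∪
  {r | ∃ j : p.ThroughBlock → Fin N, ∃ γ' ∈ p.lowerInvalid N, r = p.lowerSum u.transpose j γ'}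

/-- The quantum space relations `R^{Sp}_p(x)` for `d ≤ N` vectors of length `N` (the columns of
`x`), as the set of the elements that they set to zero. Labelings with values in `[d]` are regarded
as labelings with values in `[N]`. -/
def spaceRelations (hd : d ≤ N) (x : Matrix (Fin N) (Fin d) A) : Set A :=
  {r | ∃ i j : p.ThroughBlock → Fin N, ∃ (γ : Fin p.k → Fin d) (γ' : Fin p.l → Fin d),
      Fin.castLE hd ∘ γ ∈ p.upperClass j ∧ Fin.castLE hd ∘ γ' ∈ p.lowerClass j ∧
      r = p.upperSum x i γ - p.lowerSum x i γ'} ∪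
  {r | ∃ (i : p.ThroughBlock → Fin N) (γ : Fin p.k → Fin d),
      Fin.castLE hd ∘ γ ∈ p.upperInvalid N ∧ r = p.upperSum x i γ} ∪
  {r | ∃ (i : p.ThroughBlock → Fin N) (γ' : Fin p.l → Fin d),
      Fin.castLE hd ∘ γ' ∈ p.lowerInvalid N ∧ r = p.lowerSum x i γ'}

/-! The relations of one mixed-coloured pair partition bound the generators. -/

instance (c₁ c₂ : Colour) : IsEmpty (lowerPair c₁ c₂).ThroughBlock :=
  ⟨fun b => Fin.elim0 b.2.1.choose⟩

theorem const_mem_lowerClass (i : p.ThroughBlock → Fin N) (j : Fin N) [IsEmpty p.ThroughBlock] :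
    (fun _ => j) ∈ p.lowerClass i :=
  ⟨fun _ _ _ => rfl, fun _ b => isEmptyElim b⟩

theorem mem_upperClass_lowerPair {c₁ c₂ : Colour} (i : (lowerPair c₁ c₂).ThroughBlock → Fin N)
    (t : Fin (lowerPair c₁ c₂).k → Fin N) : t ∈ (lowerPair c₁ c₂).upperClass i :=
  ⟨fun a => Fin.elim0 a, fun a => Fin.elim0 a⟩

theorem upperSum_lowerPair {c₁ c₂ : Colour} (x : Matrix (Fin N) (Fin d) A)
    (i : (lowerPair c₁ c₂).ThroughBlock → Fin N) (γ : Fin (lowerPair c₁ c₂).k → Fin d) :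
    (lowerPair c₁ c₂).upperSum x i γ = 1 := by
  classical
  unfold upperSum
  refine (Finset.sum_eq_single (fun a => Fin.elim0 a) (fun t _ ht => ?_) fun h => ?_).trans ?_
  · exact absurd (funext fun a => Fin.elim0 a) ht
  · exact absurd (Finset.mem_filter.2 ⟨Finset.mem_univ _, mem_upperClass_lowerPair i _⟩) h
  · rfl

theorem lowerSum_lowerPair {c₁ c₂ : Colour} (x : Matrix (Fin N) (Fin d) A)
    (i : (lowerPair c₁ c₂).ThroughBlock → Fin N) (j : Fin d) :
    (lowerPair c₁ c₂).lowerSum x i (fun _ => j) =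
      ∑ s : Fin N, c₁.pow (x s j) * c₂.pow (x s j) := by
  classical
  unfold lowerSum
  symm
  refine Finset.sum_bij (fun s _ => fun _ => s) (fun s _ => ?_) (fun s _ s' _ h => ?_)
    (fun t ht => ?_) (fun s _ => ?_)
  · exact Finset.mem_filter.2 ⟨Finset.mem_univ _, const_mem_lowerClass _ i s⟩
  · exact congrFun h (0 : Fin 2)
  · have h := (Finset.mem_filter.1 ht).2.1
    exact ⟨t (0 : Fin 2), Finset.mem_univ _, funext fun a => h _ _ trivial⟩
  · change _ = (List.ofFn fun a : Fin 2 => (![c₁, c₂] a).pow (x s j)).prod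
    simp [List.ofFn_succ]

end TwoColouredPartition

theorem CStarAlgebra.norm_le_one_of_sum_mul_star {D ι : Type*} [CStarAlgebra D] [Fintype ι]
    (y : ι → D) (h : ∑ i, y i * star (y i) = 1) (i : ι) : ‖y i‖ ≤ 1 := by
  let _ : PartialOrder D := CStarAlgebra.spectralOrder D
  have _ : StarOrderedRing D := CStarAlgebra.spectralOrderedRing D
  have h1 : y i * star (y i) ≤ 1 := by
    rw [← h]
    exact Finset.single_le_sum (f := fun i => y i * star (y i))
      (fun i _ => mul_star_self_nonneg (y i)) (Finset.mem_univ i)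
  have h2 : ‖y i * star (y i)‖ ≤ 1 :=
    (CStarAlgebra.norm_le_one_iff_of_nonneg _ (mul_star_self_nonneg (y i))).2 h1
  rw [CStarRing.norm_self_mul_star] at h2
  nlinarith [norm_nonneg (y i)]

theorem CStarSeminorm.le_one_of_relation {E ι : Type*} [Fintype ι]
    (p : CStarSeminorm (FreeStarAlgebra E)) (e : ι → E)
    (h : p (1 - ∑ s, FreeStarAlgebra.gen (e s) * star (FreeStarAlgebra.gen (e s))) = 0) (s : ι) :
    p (FreeStarAlgebra.gen (e s)) ≤ 1 := by
  have h1 : p.inclHom (1 - ∑ s, FreeStarAlgebra.gen (e s) * star (FreeStarAlgebra.gen (e s))) = 0 :=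
    norm_eq_zero.1 ((p.norm_incl _).trans h)
  rw [map_sub, map_one, map_sum, sub_eq_zero] at h1
  simp only [map_mul, map_star] at h1
  rw [← p.norm_incl]
  exact CStarAlgebra.norm_le_one_of_sum_mul_star (fun s => p.inclHom (FreeStarAlgebra.gen (e s)))
    h1.symm s

/-! ### Easy quantum groups and partition quantum spaces -/

open TwoColouredPartition

/-- The matrix of free generators. -/
def freeMatrix (m n : ℕ) : Matrix (Fin m) (Fin n) (FreeStarAlgebra (Fin m × Fin n)) :=
  Matrix.of fun i j => FreeStarAlgebra.gen (i, j)

/-- The relations `R^{Gr}_p(u)` for all `p ∈ P`. -/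
def easyRelations (N : ℕ) (P : Set TwoColouredPartition) :
    Set (FreeStarAlgebra (Fin N × Fin N)) :=
  ⋃ p ∈ P, p.groupRelations (freeMatrix N N)

/-- The relations `R^{Sp}_p(x)` for all `p ∈ P`. -/
def pqsRelations {N d : ℕ} (hd : d ≤ N) (P : Set TwoColouredPartition) :
    Set (FreeStarAlgebra (Fin N × Fin d)) :=
  ⋃ p ∈ P, p.spaceRelations hd (freeMatrix N d)

theorem universalExists_easyRelations (N : ℕ) {P : Set TwoColouredPartition}
    (hP : mixedPairs ⊆ P) : UniversalExists (easyRelations N P) := by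
  refine universalExists_of_gen_le_one _ fun p hp e => ?_
  refine p.le_one_of_relation (fun s => (e.1, s)) (hp _ ?_) e.2
  refine Set.mem_biUnion (hP (Or.inl rfl)) (Or.inl (Or.inl ?_))
  refine ⟨isEmptyElim, isEmptyElim, fun a => Fin.elim0 a, mem_upperClass_lowerPair _ _,
    fun _ => e.1, const_mem_lowerClass _ _ _, ?_⟩
  rw [upperSum_lowerPair, lowerSum_lowerPair]
  rfl

theorem universalExists_pqsRelations {N d : ℕ} (hd : d ≤ N) {P : Set TwoColouredPartition}
    (hP : mixedPairs ⊆ P) : UniversalExists (pqsRelations hd P) := by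
  refine universalExists_of_gen_le_one _ fun p hp e => ?_
  refine p.le_one_of_relation (fun s => (s, e.2)) (hp _ ?_) e.1
  refine Set.mem_biUnion (hP (Or.inl rfl)) (Or.inl (Or.inl ?_))
  refine ⟨isEmptyElim, isEmptyElim, fun a => Fin.elim0 a, fun _ => e.2,
    mem_upperClass_lowerPair _ _, const_mem_lowerClass _ _ (Fin.castLE hd e.2), ?_⟩
  rw [upperSum_lowerPair, lowerSum_lowerPair]
  rfl

/-- The C*-algebra `C(G_N(P))` of the easy quantum group `G_N(P)`. -/
abbrev EasyQuantumGroup (N : ℕ) (P : Set TwoColouredPartition) (hP : mixedPairs ⊆ P) : Type :=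
  UniversalCStarAlgebra (easyRelations N P) (universalExists_easyRelations N hP)

/-- The matrix of generators `u = (u_{ij})` of `C(G_N(P))`. -/
def EasyQuantumGroup.u (N : ℕ) (P : Set TwoColouredPartition) (hP : mixedPairs ⊆ P) :
    Matrix (Fin N) (Fin N) (EasyQuantumGroup N P hP) :=
  Matrix.of fun i j =>
    UniversalCStarAlgebra.gen (easyRelations N P) (universalExists_easyRelations N hP) (i, j)

/-- The C*-algebra `C(X_{N,d}(P))` of the partition quantum space `X_{N,d}(P)` of `d` vectors. -/
abbrev PartitionQuantumSpace {N d : ℕ} (hd : d ≤ N) (P : Set TwoColouredPartition)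
    (hP : mixedPairs ⊆ P) : Type :=
  UniversalCStarAlgebra (pqsRelations hd P) (universalExists_pqsRelations hd hP)

/-- The `d` vectors of generators `x = (x_{ij})` of `C(X_{N,d}(P))`. -/
def PartitionQuantumSpace.x {N d : ℕ} (hd : d ≤ N) (P : Set TwoColouredPartition)
    (hP : mixedPairs ⊆ P) : Matrix (Fin N) (Fin d) (PartitionQuantumSpace hd P hP) :=
  Matrix.of fun i j =>
    UniversalCStarAlgebra.gen (pqsRelations hd P) (universalExists_pqsRelations hd hP) (i, j)

/-! ### Compact matrix quantum groups and matrix-vector actions -/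

/-- The entries of the matrix `x` generate `A` as a unital C*-algebra. -/
def GeneratesCStar {A : Type*} [CStarAlgebra A] {m n : ℕ} (x : Matrix (Fin m) (Fin n) A) : Prop :=
  (StarAlgebra.adjoin ℂ (Set.range fun ij : Fin m × Fin n => x ij.1 ij.2)).topologicalClosure = ⊤

/-- `A` is the C*-algebra `C(G)` of a compact matrix quantum group `G` with matrix of
generators `u`. -/
structure IsCompactMatrixQuantumGroup {A : Type*} [CStarAlgebra A] {N : ℕ}
    (u : Matrix (Fin N) (Fin N) A) : Prop where
  generates : GeneratesCStar u
  isUnit : IsUnit u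
  isUnit_conj : IsUnit (u.map star)
  exists_comul : ∃ Δ : A →⋆ₐ[ℂ] MinTensor A A,
    ∀ i j, Δ (u i j) = ∑ k, MinTensor.tmul (u i k) (u k j)

/-- The unital *-homomorphism `α` is a left matrix-vector action of `G` on `X`:
`α(x_{ij}) = ∑_k u_{ik} ⊗ x_{kj}`. -/
def IsLeftMatrixVectorAction {A B : Type*} [CStarAlgebra A] [CStarAlgebra B] {N d : ℕ}
    (u : Matrix (Fin N) (Fin N) A) (x : Matrix (Fin N) (Fin d) B)
    (α : B →⋆ₐ[ℂ] MinTensor A B) : Prop :=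
  ∀ i j, α (x i j) = ∑ k, MinTensor.tmul (u i k) (x k j)

/-- The unital *-homomorphism `β` is a right matrix-vector action of `G` on `X`:
`β(x_{ij}) = ∑_k u_{ki} ⊗ x_{kj}`. -/
def IsRightMatrixVectorAction {A B : Type*} [CStarAlgebra A] [CStarAlgebra B] {N d : ℕ}
    (u : Matrix (Fin N) (Fin N) A) (x : Matrix (Fin N) (Fin d) B)
    (β : B →⋆ₐ[ℂ] MinTensor A B) : Prop :=
  ∀ i j, β (x i j) = ∑ k, MinTensor.tmul (u k i) (x k j)

end

/-!
Let `E` and `F` be the 0-1 matrices whose columns indicate the sets `T_i` and `T'_i`, and let `W(u)`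
and `W'(u)` be the matrices of the words in the entries of `u` with the upper and the lower colours.
The relations `R^{Gr}_p(u)` say that `T = F Eᵀ` satisfies `T W(u) = W'(u) T`. For the mixed-coloured
pair partitions they say that `u` and its entrywise adjoint are unitary, so that `W(u)` and `W'(u)`
are unitary and `W(u) T* = T* W'(u)` as well. Since all `T_i` have the same positive size, and so
have all `T'_i`, `Eᵀ E` and `Fᵀ F` are nonzero multiples of the identity. Compressing the two
intertwining relations therefore gives one matrix `c` with `Eᵀ W(u) = c Eᵀ` and `Fᵀ W'(u) = c Fᵀ`,
and its transpose `cᵀ` does the same for `uᵀ`.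

Words are multiplicative, `W(a b) = W(a) W(b)`, if the entries of `a` and their adjoints commute
with those of `b`, as they do when `a` and `b` come from different tensor legs. So the product of
the copies of `u` in the two legs of `C(G_N(Π)) ⊗ C(G_N(Π))` satisfies `R^{Gr}_p`. The relations
`R^{Sp}_p(x)` restrict how the columns of `Eᵀ W(x)` and `Fᵀ W'(x)` depend on the column index, and
replacing `x` by `u x` or by `uᵀ x` multiplies both matrices from the left by `c` or by `cᵀ`,
which preserves such restrictions. The universal properties yield `Δ`, `α` and `β`.
-/

noncomputable section

open scoped TensorProduct Kronecker Function Matrix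

/-! ### The universal property -/

namespace Colour

variable {A B F : Type*}

theorem map_pow [Star A] [Star B] [FunLike F A B] [StarHomClass F A B] (φ : F) (c : Colour)
    (a : A) : φ (c.pow a) = c.pow (φ a) := by
  cases c
  · rfl
  · exact map_star φ a

theorem flip_pow [InvolutiveStar A] (c : Colour) (a : A) : c.flip.pow a = star (c.pow a) := by
  cases c
  · rfl
  · exact (star_star a).symm

theorem pow_mem {S : Type*} [Star A] [SetLike S A] [StarMemClass S A] {s : S} {a : A} (ha : a ∈ s)
    (c : Colour) : c.pow a ∈ s := by
  cases c
  · exact ha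
  · exact star_mem ha

end Colour

namespace FreeStarAlgebra

variable {E D : Type*} [Ring D] [StarRing D]

/-- The value of a word under the substitution `e ↦ x e`. -/
def wordEval (x : E → D) : FreeMonoid (E × Colour) →* D :=
  FreeMonoid.lift fun a => a.2.pow (x a.1)

theorem wordEval_of (x : E → D) (a : E × Colour) :
    wordEval x (FreeMonoid.of a) = a.2.pow (x a.1) :=
  FreeMonoid.lift_eval_of _ _

theorem wordEval_wordStar (x : E → D) (w : FreeMonoid (E × Colour)) :
    wordEval x (wordStar w) = star (wordEval x w) := by
  induction w using FreeMonoid.inductionOn' with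
  | one => exact (map_one _).trans (by rw [map_one, star_one])
  | of_mul a w ih =>
    have hof : wordStar (FreeMonoid.of a) = FreeMonoid.of (a.1, a.2.flip) := rfl
    rw [wordStar_mul, map_mul, ih, map_mul, star_mul, hof, wordEval_of, wordEval_of,
      Colour.flip_pow]

variable [Algebra ℂ D]

/-- The value of *-polynomials under the substitution `e ↦ x e`, as an algebra homomorphism. -/
def evalAlgHom (x : E → D) : FreeStarAlgebra E →ₐ[ℂ] D :=
  MonoidAlgebra.lift ℂ D (FreeMonoid (E × Colour)) (wordEval x)

theorem evalAlgHom_term (x : E → D) (w : FreeMonoid (E × Colour)) (c : ℂ) :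
    evalAlgHom x (term w c) = c • wordEval x w :=
  MonoidAlgebra.lift_single _ _ _

/-- The value of *-polynomials under the substitution `e ↦ x e`, as a *-homomorphism. -/
def eval [StarModule ℂ D] (x : E → D) : FreeStarAlgebra E →⋆ₐ[ℂ] D :=
  { evalAlgHom x with
    map_star' := fun f => by
      change evalAlgHom x (star f) = star (evalAlgHom x f)
      induction f using FreeStarAlgebra.induction with
      | zero => simp only [star_zero, map_zero]
      | add f g hf hg => rw [star_add, map_add, hf, hg, map_add, star_add]
      | term w c =>
        rw [star_term, evalAlgHom_term, evalAlgHom_term, wordEval_wordStar, star_smul] }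

theorem eval_gen [StarModule ℂ D] (x : E → D) (e : E) : eval x (gen e) = x e := by
  change evalAlgHom x (gen e) = x e
  rw [gen, evalAlgHom_term, one_smul, wordEval_of]
  rfl

theorem term_one_eq_wordEval_gen (w : FreeMonoid (E × Colour)) : term w 1 = wordEval gen w := by
  let termHom : FreeMonoid (E × Colour) →* FreeStarAlgebra E := MonoidAlgebra.of ℂ _
  have h : termHom = wordEval gen :=
    FreeMonoid.hom_eq fun a => (term_of a.1 a.2).trans (wordEval_of gen a).symm
  exact DFunLike.congr_fun h w

theorem adjoin_range_gen :
    StarAlgebra.adjoin ℂ (Set.range (gen : E → FreeStarAlgebra E)) = ⊤ := by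
  refine eq_top_iff.2 fun f _ => ?_
  induction f using FreeStarAlgebra.induction with
  | zero => exact zero_mem _
  | add f g hf hg => exact add_mem (hf trivial) (hg trivial)
  | term w c =>
    rw [← mul_one c, ← smul_term, term_one_eq_wordEval_gen, wordEval, FreeMonoid.lift_apply]
    refine SMulMemClass.smul_mem c (list_prod_mem ?_)
    simp only [List.mem_map, forall_exists_index, and_imp, forall_apply_eq_imp_iff₂]
    exact fun a _ =>
      Colour.pow_mem (StarAlgebra.subset_adjoin ℂ _ (Set.mem_range_self a.1)) a.2

end FreeStarAlgebra

namespace CStarSeminorm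

variable {R D : Type*} [Ring R] [StarRing R] [Algebra ℂ R] [CStarAlgebra D]

/-- The C*-seminorm `x ↦ ‖φ x‖`. -/
def ofStarAlgHom (φ : R →⋆ₐ[ℂ] D) : CStarSeminorm R where
  toFun x := ‖φ x‖
  map_zero' := by rw [map_zero, norm_zero]
  add_le' x y := by rw [map_add]; exact norm_add_le _ _
  neg' x := by rw [map_neg, norm_neg]
  smul' c x := by rw [map_smul, norm_smul]
  mul_le' x y := by rw [map_mul]; exact norm_mul_le _ _
  star_mul_self' x := by rw [map_mul, map_star, CStarRing.norm_star_mul_self, sq]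

variable (p : CStarSeminorm R)

theorem exists_extension (φ : R →⋆ₐ[ℂ] D) (h : ∀ x, ‖φ x‖ ≤ p x) :
    ∃ ψ : p.Completion →⋆ₐ[ℂ] D, ∀ x, ψ (p.inclHom x) = φ x := by
  let f : p.Carrier →+* D := (φ : R →+* D)
  have hf : Continuous f :=
    AddMonoidHomClass.continuous_of_bound f 1 fun x => (h x).trans_eq (one_mul _).symm
  let g : UniformSpace.Completion p.Carrier →+* D := UniformSpace.Completion.extensionHom f hf
  have hg : Continuous g := UniformSpace.Completion.continuous_extension
  have hgf : ∀ x : R, g (p.incl x) = φ x := fun x =>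
    UniformSpace.Completion.extensionHom_coe f hf x
  refine ⟨{ g with
    commutes' := fun c => (hgf (algebraMap ℂ R c)).trans (AlgHomClass.commutes φ c)
    map_star' := fun x => ?_ }, hgf⟩
  change g (star x : p.Completion) = star (g x)
  refine p.denseRange_incl.induction_on x (isClosed_eq
    (hg.comp p.continuous_star_completion) (continuous_star.comp hg)) fun a => ?_
  rw [← incl_star, hgf, hgf, map_star]

end CStarSeminorm

namespace UniversalCStarAlgebra

open scoped CStarAlgebra

variable {E D : Type*} [CStarAlgebra D] (R : Set (FreeStarAlgebra E)) (hR : UniversalExists R)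

/-- The canonical map from the free *-algebra to `C*(E | R)`. -/
def ofFree : FreeStarAlgebra E →⋆ₐ[ℂ] UniversalCStarAlgebra R hR :=
  (CStarSeminorm.sup (relationSeminorms R) hR).inclHom

theorem ofFree_eq_zero {r : FreeStarAlgebra E} (hr : r ∈ R) : ofFree R hR r = 0 := by
  refine norm_eq_zero.1 ((CStarSeminorm.norm_incl _ r).trans ?_)
  change (⨆ p : relationSeminorms R, p.1 r) = 0
  simp only [fun p : relationSeminorms R => p.2 r hr, Real.iSup_const_zero]

theorem exists_lift (x : E → D) (hx : ∀ r ∈ R, FreeStarAlgebra.eval x r = 0) :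
    ∃ φ : UniversalCStarAlgebra R hR →⋆ₐ[ℂ] D, ∀ e, φ (gen R hR e) = x e := by
  obtain ⟨φ, hφ⟩ := CStarSeminorm.exists_extension (CStarSeminorm.sup (relationSeminorms R) hR)
    (FreeStarAlgebra.eval x) fun f =>
      le_ciSup (hR f) ⟨CStarSeminorm.ofStarAlgHom (FreeStarAlgebra.eval x), fun r hr =>
        norm_eq_zero.2 (hx r hr)⟩
  exact ⟨φ, fun e => (hφ _).trans (FreeStarAlgebra.eval_gen x e)⟩

theorem topologicalClosure_adjoin_gen :
    (StarAlgebra.adjoin ℂ (Set.range (gen R hR))).topologicalClosure = ⊤ := by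
  have hrange : StarAlgebra.adjoin ℂ (Set.range (gen R hR)) = (ofFree R hR).range := by
    rw [StarAlgHom.range_eq_map_top, ← FreeStarAlgebra.adjoin_range_gen, StarAlgHom.map_adjoin,
      ← Set.range_comp]
    rfl
  rw [hrange]
  exact eq_top_iff.2 fun y _ => CStarSeminorm.denseRange_incl _ y

theorem hom_ext {φ ψ : UniversalCStarAlgebra R hR →⋆ₐ[ℂ] D}
    (h : ∀ e, φ (gen R hR e) = ψ (gen R hR e)) : φ = ψ := by
  have hfree : φ.comp (ofFree R hR) = ψ.comp (ofFree R hR) :=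
    StarAlgHom.ext_of_adjoin_eq_top FreeStarAlgebra.adjoin_range_gen
      (Set.forall_mem_range.2 h)
  exact DFunLike.coe_injective <| (CStarSeminorm.denseRange_incl _).equalizer (map_continuous φ)
    (map_continuous ψ) (funext (DFunLike.congr_fun hfree))

end UniversalCStarAlgebra

/-! ### The two legs of the minimal tensor product -/

namespace MinTensor

universe u v

variable (A : Type u) (B : Type v) [CStarAlgebra A] [CStarAlgebra B]

/-- The canonical map from the algebraic to the minimal tensor product. -/
def ofAlgebraic : A ⊗[ℂ] B →⋆ₐ[ℂ] MinTensor A B :=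
  (CStarSeminorm.sup (spatialSeminorms A B) (bddAbove_spatialSeminorms A B)).inclHom

/-- The unital *-homomorphism `a ↦ a ⊗ 1`. -/
def inLeft : A →⋆ₐ[ℂ] MinTensor A B :=
  (ofAlgebraic A B).comp
    { (Algebra.TensorProduct.includeLeft : A →ₐ[ℂ] A ⊗[ℂ] B) with
      map_star' := fun a => (congrArg (star a ⊗ₜ[ℂ] ·) (star_one B).symm).trans
        (TensorProduct.star_tmul a (1 : B)).symm }

/-- The unital *-homomorphism `b ↦ 1 ⊗ b`. -/
def inRight : B →⋆ₐ[ℂ] MinTensor A B :=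
  (ofAlgebraic A B).comp
    { (Algebra.TensorProduct.includeRight : B →ₐ[ℂ] A ⊗[ℂ] B) with
      map_star' := fun b => (congrArg (· ⊗ₜ[ℂ] star b) (star_one A).symm).trans
        (TensorProduct.star_tmul (1 : A) b).symm }

variable {A B}

theorem inLeft_mul_inRight (a : A) (b : B) : inLeft A B a * inRight A B b = tmul a b := by
  change ofAlgebraic A B (a ⊗ₜ 1) * ofAlgebraic A B (1 ⊗ₜ b) = ofAlgebraic A B (a ⊗ₜ b)
  rw [← map_mul, Algebra.TensorProduct.tmul_mul_tmul, mul_one, one_mul]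

theorem inRight_mul_inLeft (a : A) (b : B) : inRight A B b * inLeft A B a = tmul a b := by
  change ofAlgebraic A B (1 ⊗ₜ b) * ofAlgebraic A B (a ⊗ₜ 1) = ofAlgebraic A B (a ⊗ₜ b)
  rw [← map_mul, Algebra.TensorProduct.tmul_mul_tmul, mul_one, one_mul]

theorem commute_inLeft_inRight (a : A) (b : B) : Commute (inLeft A B a) (inRight A B b) :=
  (inLeft_mul_inRight a b).trans (inRight_mul_inLeft a b).symm

end MinTensor

/-! ### Matrices of words -/

section WordMatrix

variable {l m n o : Type*} {A B : Type*}

theorem mul_kronecker_mul_of_commute [Semiring A] [Fintype m] [Fintype n] {l' o' : Type*}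
    (a : Matrix l m A) (b : Matrix m o A) (a' : Matrix l' n A) (b' : Matrix n o' A)
    (h : ∀ i j i' j', Commute (b i j) (a' i' j')) :
    (a * b) ⊗ₖ (a' * b') = (a ⊗ₖ a') * (b ⊗ₖ b') := by
  ext ⟨i, i'⟩ ⟨j, j'⟩
  simp only [Matrix.kroneckerMap_apply, Matrix.mul_apply, Finset.sum_mul_sum,
    Fintype.sum_prod_type]
  exact Finset.sum_congr rfl fun s _ => Finset.sum_congr rfl fun s' _ =>
    (h s j i' s').mul_mul_mul_comm _ _

theorem submatrix_equiv_mem_unitary [Semiring A] [StarRing A] [Fintype m] [DecidableEq m]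
    [Fintype n] [DecidableEq n] {U : Matrix m m A} (hU : U ∈ unitary (Matrix m m A))
    (e : n ≃ m) : U.submatrix e e ∈ unitary (Matrix n n A) := by
  rw [Unitary.mem_iff, Matrix.star_eq_conjTranspose] at hU ⊢
  rw [Matrix.conjTranspose_submatrix, Matrix.submatrix_mul_equiv, Matrix.submatrix_mul_equiv,
    hU.1, hU.2, Matrix.submatrix_one_equiv]
  exact ⟨rfl, rfl⟩

section Monoid

variable [Monoid A] [Star A] {k : ℕ}

/-- The matrix of the words `x_{t_1 s_1}^{ω_1} ⋯ x_{t_k s_k}^{ω_k}`, indexed by labelings of `k`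
points. It is the `k`-fold tensor power of `x` with colours `ω`. -/
def wordMatrix (ω : Fin k → Colour) (x : Matrix m n A) : Matrix (Fin k → m) (Fin k → n) A :=
  Matrix.of fun t s => (List.ofFn fun a => (ω a).pow (x (t a) (s a))).prod

theorem wordMatrix_apply (ω : Fin k → Colour) (x : Matrix m n A) (t : Fin k → m) (s : Fin k → n) :
    wordMatrix ω x t s = (List.ofFn fun a => (ω a).pow (x (t a) (s a))).prod :=
  rfl

theorem wordMatrix_transpose (ω : Fin k → Colour) (x : Matrix m n A) :
    wordMatrix ω x.transpose = (wordMatrix ω x).transpose :=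
  rfl

theorem wordMatrix_map {F : Type*} [Monoid B] [Star B] [FunLike F A B] [MonoidHomClass F A B]
    [StarHomClass F A B] (φ : F) (ω : Fin k → Colour) (x : Matrix m n A) :
    wordMatrix ω (x.map φ) = (wordMatrix ω x).map φ := by
  ext t s
  simp only [Matrix.map_apply, wordMatrix_apply, map_list_prod, List.map_ofFn, Function.comp_def,
    Colour.map_pow]

theorem wordMatrix_fin_zero_apply (ω : Fin 0 → Colour) (x : Matrix m n A) (t : Fin 0 → m)
    (s : Fin 0 → n) : wordMatrix ω x t s = 1 := by
  rw [wordMatrix_apply, List.ofFn_zero, List.prod_nil]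

end Monoid

theorem wordMatrix_succ [Semiring A] [StarRing A] {k : ℕ} (ω : Fin (k + 1) → Colour)
    (x : Matrix m n A) :
    wordMatrix ω x = (x.map (ω 0).pow ⊗ₖ wordMatrix (Fin.tail ω) x).submatrix
      (Fin.consEquiv fun _ => m).symm (Fin.consEquiv fun _ => n).symm := by
  ext t s
  rw [wordMatrix_apply, List.ofFn_succ, List.prod_cons]
  rfl

section Semiring

variable [Semiring A] [StarRing A]

/-- The entries of `a` and their adjoints commute with the entries of `b` and their adjoints. -/
def EntriesStarCommute (a : Matrix l m A) (b : Matrix n o A) : Prop :=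
  ∀ i j i' j' (c c' : Colour), Commute (c.pow (a i j)) (c'.pow (b i' j'))

theorem EntriesStarCommute.map_pow_mul [Fintype m] {a : Matrix l m A} {b : Matrix m n A}
    (h : EntriesStarCommute a b) (c : Colour) :
    (a * b).map c.pow = a.map c.pow * b.map c.pow := by
  ext i j
  cases c
  · rfl
  · exact (star_sum _ _).trans (Finset.sum_congr rfl fun s _ => (star_mul _ _).trans
      (h i s s j .black .black).symm.eq)

theorem EntriesStarCommute.commute_wordMatrix {k : ℕ} {a : Matrix l m A} {b : Matrix n o A}
    (h : EntriesStarCommute a b) (ω : Fin k → Colour) (c : Colour) (i : n) (j : o)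
    (t : Fin k → l) (s : Fin k → m) : Commute (c.pow (b i j)) (wordMatrix ω a t s) := by
  refine Commute.list_prod_right _ _ fun y hy => ?_
  obtain ⟨r, rfl⟩ := (List.mem_ofFn' _ _).1 hy
  exact (h _ _ _ _ _ _).symm

theorem wordMatrix_mul [Fintype m] {a : Matrix l m A} {b : Matrix m n A}
    (h : EntriesStarCommute a b) {k : ℕ} (ω : Fin k → Colour) :
    wordMatrix ω (a * b) = wordMatrix ω a * wordMatrix ω b := by
  induction k with
  | zero =>
    ext t s
    simp only [Matrix.mul_apply, wordMatrix_fin_zero_apply, mul_one, Fintype.sum_unique]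
  | succ k ih =>
    rw [wordMatrix_succ, wordMatrix_succ, wordMatrix_succ, Matrix.submatrix_mul_equiv, ih,
      h.map_pow_mul, mul_kronecker_mul_of_commute]
    exact fun _ _ _ _ => h.commute_wordMatrix _ _ _ _ _ _

theorem wordMatrix_fin_zero [DecidableEq m] (ω : Fin 0 → Colour) (u : Matrix m m A) :
    wordMatrix ω u = 1 := by
  ext t s
  rw [wordMatrix_fin_zero_apply, Subsingleton.elim t s, Matrix.one_apply_eq]

theorem wordMatrix_mem_unitary [Fintype m] [DecidableEq m] {u : Matrix m m A}
    (hu : ∀ c : Colour, u.map c.pow ∈ unitary (Matrix m m A)) {k : ℕ} (ω : Fin k → Colour) :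
    wordMatrix ω u ∈ unitary (Matrix (Fin k → m) (Fin k → m) A) := by
  induction k with
  | zero => exact wordMatrix_fin_zero ω u ▸ one_mem _
  | succ k ih =>
    rw [wordMatrix_succ]
    exact submatrix_equiv_mem_unitary (Matrix.kronecker_mem_unitary (hu _) (ih _)) _

end Semiring

end WordMatrix

/-! ### Matrices that are constant on classes -/

section ClassIndicator

variable {X Y Z ι A : Type*}

theorem transpose_mul_of_commute [NonUnitalNonAssocSemiring A] [Fintype Y] {M : Matrix X Y A}
    {M' : Matrix Y Z A} (h : ∀ i j k, Commute (M i j) (M' j k)) : (M * M')ᵀ = M'ᵀ * Mᵀ := by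
  ext k i
  exact Finset.sum_congr rfl fun j _ => h i j k

/-- The 0-1 matrix whose columns are the indicator functions of the classes `C i`. -/
def classIndicator (A : Type*) [Zero A] [One A] (C : ι → Set X) : Matrix X ι A :=
  Matrix.of fun t i => (C i).indicator 1 t

section Apply

variable [Zero A] [One A] {C : ι → Set X} {t : X} {i : ι}

theorem classIndicator_apply_of_mem (h : t ∈ C i) : classIndicator A C t i = 1 :=
  Set.indicator_of_mem h 1

theorem classIndicator_apply_of_notMem (h : t ∉ C i) : classIndicator A C t i = 0 :=
  Set.indicator_of_notMem h 1

end Apply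

/-- A family of nonempty and pairwise disjoint classes that all have the same cardinality. -/
structure IsUniformFamily (C : ι → Set X) : Prop where
  nonempty : ∀ i, (C i).Nonempty
  disjoint : Pairwise (Disjoint on C)
  ncard_eq : ∀ i j, (C i).ncard = (C j).ncard

variable [Semiring A] {C : ι → Set X} {D : ι → Set Y}

theorem commute_classIndicator_apply (C : ι → Set X) (t : X) (i : ι) (a : A) :
    Commute (classIndicator A C t i) a := by
  by_cases h : t ∈ C i
  · exact classIndicator_apply_of_mem (A := A) h ▸ Commute.one_left a
  · exact classIndicator_apply_of_notMem (A := A) h ▸ Commute.zero_left a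

theorem conjTranspose_classIndicator [StarRing A] (C : ι → Set X) :
    (classIndicator A C)ᴴ = (classIndicator A C)ᵀ := by
  ext i t
  by_cases h : t ∈ C i
  · simp only [Matrix.conjTranspose_apply, Matrix.transpose_apply, classIndicator_apply_of_mem h,
      star_one]
  · simp only [Matrix.conjTranspose_apply, Matrix.transpose_apply,
      classIndicator_apply_of_notMem h, star_zero]

section Finite

variable [Fintype X]

theorem transpose_mul_classIndicator (M : Matrix Z X A) (C : ι → Set X) :
    (M * classIndicator A C)ᵀ = (classIndicator A C)ᵀ * Mᵀ :=
  transpose_mul_of_commute fun _ t i => (commute_classIndicator_apply C t i _).symm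

open scoped Classical in
theorem classIndicator_transpose_mul_apply (C : ι → Set X) (M : Matrix X Z A) (i : ι) (s : Z) :
    ((classIndicator A C)ᵀ * M) i s = ∑ t with t ∈ C i, M t s := by
  simp only [Matrix.mul_apply, classIndicator, Matrix.transpose_apply, Matrix.of_apply,
    Set.indicator_apply, Pi.one_apply, ite_mul, one_mul, zero_mul, Finset.sum_ite,
    Finset.sum_const_zero, add_zero]

theorem IsUniformFamily.exists_transpose_mul_self_eq_smul [DecidableEq ι] (K : Type*) [Field K]
    [CharZero K] [Module K A] (hC : IsUniformFamily C) :
    ∃ c : K, c ≠ 0 ∧ (classIndicator A C)ᵀ * classIndicator A C = c • 1 := by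
  rcases isEmpty_or_nonempty ι with hι | ⟨⟨i₀⟩⟩
  · exact ⟨1, one_ne_zero, Subsingleton.elim _ _⟩
  refine ⟨(C i₀).ncard, Nat.cast_ne_zero.2 ((hC.nonempty i₀).ncard_pos.ne'), ?_⟩
  classical
  ext i j
  rw [classIndicator_transpose_mul_apply, Nat.cast_smul_eq_nsmul, Matrix.smul_apply]
  rcases eq_or_ne i j with rfl | hij
  · rw [Finset.sum_congr rfl fun t ht => classIndicator_apply_of_mem (Finset.mem_filter.1 ht).2,
      Finset.sum_const, Matrix.one_apply_eq, hC.ncard_eq i₀ i, Set.ncard_eq_toFinset_card',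
      Set.toFinset_card, Fintype.card_subtype]
  · rw [Matrix.one_apply_ne hij, smul_zero]
    exact Finset.sum_eq_zero fun t ht => classIndicator_apply_of_notMem
      (Set.disjoint_left.1 (hC.disjoint hij) (Finset.mem_filter.1 ht).2)

end Finite

variable [Fintype ι]

theorem transpose_classIndicator_mul (C : ι → Set X) (M : Matrix ι Z A) :
    (classIndicator A C * M)ᵀ = Mᵀ * (classIndicator A C)ᵀ :=
  transpose_mul_of_commute fun t i _ => commute_classIndicator_apply C t i _

theorem classIndicator_mul_apply_of_mem (hC : Pairwise (Disjoint on C)) {t : X} {i : ι}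
    (ht : t ∈ C i) (M : Matrix ι Z A) (s : Z) : (classIndicator A C * M) t s = M i s := by
  rw [Matrix.mul_apply, Fintype.sum_eq_single i, classIndicator_apply_of_mem ht, one_mul]
  intro j hj
  rw [classIndicator_apply_of_notMem (Set.disjoint_left.1 (hC hj.symm) ht), zero_mul]

theorem classIndicator_mul_apply_of_notMem {t : X} (ht : t ∉ ⋃ i, C i) (M : Matrix ι Z A)
    (s : Z) : (classIndicator A C * M) t s = 0 := by
  rw [Matrix.mul_apply]
  refine Finset.sum_eq_zero fun i _ => ?_
  rw [classIndicator_apply_of_notMem fun h => ht (Set.mem_iUnion_of_mem i h), zero_mul]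

theorem mul_classIndicator_transpose_apply_of_mem (hC : Pairwise (Disjoint on C)) {t : X} {i : ι}
    (ht : t ∈ C i) (M : Matrix Z ι A) (s : Z) : (M * (classIndicator A C)ᵀ) s t = M s i := by
  rw [← Matrix.transpose_transpose M, ← transpose_classIndicator_mul, Matrix.transpose_apply,
    classIndicator_mul_apply_of_mem hC ht]
  rfl

theorem mul_classIndicator_transpose_apply_of_notMem {t : X} (ht : t ∉ ⋃ i, C i)
    (M : Matrix Z ι A) (s : Z) : (M * (classIndicator A C)ᵀ) s t = 0 := by
  rw [← Matrix.transpose_transpose M, ← transpose_classIndicator_mul, Matrix.transpose_apply,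
    classIndicator_mul_apply_of_notMem ht]

theorem classIndicator_mul_eq_mul_transpose_iff (hC : IsUniformFamily C) (hD : IsUniformFamily D)
    (M : Matrix ι X A) (M' : Matrix Y ι A) :
    classIndicator A D * M = M' * (classIndicator A C)ᵀ ↔
      (∀ i j, ∀ s ∈ C j, ∀ t ∈ D i, M i s = M' t j) ∧ (∀ i, ∀ s ∉ ⋃ j, C j, M i s = 0) ∧
        ∀ j, ∀ t ∉ ⋃ i, D i, M' t j = 0 := by
  refine ⟨fun h => ⟨fun i j s hs t ht => ?_, fun i s hs => ?_, fun j t ht => ?_⟩, ?_⟩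
  · rw [← classIndicator_mul_apply_of_mem hD.disjoint ht M, h,
      mul_classIndicator_transpose_apply_of_mem hC.disjoint hs]
  · obtain ⟨t, ht⟩ := hD.nonempty i
    rw [← classIndicator_mul_apply_of_mem hD.disjoint ht M, h,
      mul_classIndicator_transpose_apply_of_notMem hs]
  · obtain ⟨s, hs⟩ := hC.nonempty j
    rw [← mul_classIndicator_transpose_apply_of_mem hC.disjoint hs M', ← h,
      classIndicator_mul_apply_of_notMem ht]
  · rintro ⟨hCD, hC₀, hD₀⟩
    ext t s
    by_cases ht : t ∈ ⋃ i, D i <;> by_cases hs : s ∈ ⋃ j, C j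
    · obtain ⟨i, ht⟩ := Set.mem_iUnion.1 ht
      obtain ⟨j, hs⟩ := Set.mem_iUnion.1 hs
      rw [classIndicator_mul_apply_of_mem hD.disjoint ht,
        mul_classIndicator_transpose_apply_of_mem hC.disjoint hs, hCD i j s hs t ht]
    · obtain ⟨i, ht⟩ := Set.mem_iUnion.1 ht
      rw [classIndicator_mul_apply_of_mem hD.disjoint ht,
        mul_classIndicator_transpose_apply_of_notMem hs, hC₀ i s hs]
    · obtain ⟨j, hs⟩ := Set.mem_iUnion.1 hs
      rw [classIndicator_mul_apply_of_notMem ht,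
        mul_classIndicator_transpose_apply_of_mem hC.disjoint hs, hD₀ j t ht]
    · rw [classIndicator_mul_apply_of_notMem ht, mul_classIndicator_transpose_apply_of_notMem hs]

end ClassIndicator

/-! ### Intertwiners -/

section Intertwiner

variable {X Y ι A : Type*} [Fintype X] [Fintype Y]

theorem exists_common_compression [Fintype ι] [DecidableEq ι] (K : Type*) [Field K] [Ring A]
    [Algebra K A]
    {E : Matrix X ι A} {E' : Matrix ι X A} {F : Matrix Y ι A} {F' : Matrix ι Y A}
    {U : Matrix X X A} {V : Matrix Y Y A} {r s : K} (hr : r ≠ 0) (hs : s ≠ 0)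
    (hE : E' * E = r • 1) (hF : F' * F = s • 1) (h : F * E' * U = V * (F * E'))
    (h' : U * (E * F') = E * F' * V) :
    ∃ c : Matrix ι ι A, E' * U = c * E' ∧ F' * V = c * F' ∧ U * E = E * c ∧ V * F = F * c := by
  obtain ⟨c, hc⟩ : ∃ c, F' * V * F = s • c := ⟨s⁻¹ • (F' * V * F), (smul_inv_smul₀ hs _).symm⟩
  have hEU : E' * U = c * E' := (isUnit_iff_ne_zero.2 hs).smul_left_cancel.1 <| calc
    s • (E' * U) = F' * (F * E' * U) := by
      rw [Matrix.mul_assoc F, ← Matrix.mul_assoc F', hF, Matrix.smul_mul, Matrix.one_mul]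
    _ = F' * V * F * E' := by rw [h]; simp only [Matrix.mul_assoc]
    _ = s • (c * E') := by rw [hc, Matrix.smul_mul]
  refine ⟨c, hEU, ?_, ?_, ?_⟩
  · exact (isUnit_iff_ne_zero.2 hr).smul_left_cancel.1 <| calc
      r • (F' * V) = E' * (E * F' * V) := by
        rw [Matrix.mul_assoc E, ← Matrix.mul_assoc E', hE, Matrix.smul_mul, Matrix.one_mul]
      _ = c * E' * (E * F') := by rw [← h', ← Matrix.mul_assoc, hEU]
      _ = r • (c * F') := by
        rw [Matrix.mul_assoc c, ← Matrix.mul_assoc E', hE, Matrix.smul_mul, Matrix.one_mul,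
          Matrix.mul_smul]
  · exact (isUnit_iff_ne_zero.2 hs).smul_left_cancel.1 <| calc
      s • (U * E) = U * (E * F') * F := by
        rw [← Matrix.mul_assoc, Matrix.mul_assoc _ F', hF, Matrix.mul_smul, Matrix.mul_one]
      _ = E * (F' * V * F) := by rw [h']; simp only [Matrix.mul_assoc]
      _ = s • (E * c) := by rw [hc, Matrix.mul_smul]
  · exact (isUnit_iff_ne_zero.2 hr).smul_left_cancel.1 <| calc
      r • (V * F) = V * (F * E') * E := by
        rw [← Matrix.mul_assoc, Matrix.mul_assoc _ E', hE, Matrix.mul_smul, Matrix.mul_one]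
      _ = F * (c * E') * E := by rw [← h, Matrix.mul_assoc F, hEU]
      _ = r • (F * c) := by
        rw [Matrix.mul_assoc F, Matrix.mul_assoc c, hE, Matrix.mul_smul, Matrix.mul_smul,
          Matrix.mul_one]

variable [DecidableEq X] [DecidableEq Y]

theorem mul_conjTranspose_eq_of_intertwines [Semiring A] [StarRing A] {T : Matrix Y X A}
    {U : Matrix X X A} {V : Matrix Y Y A} (hU : U ∈ unitary (Matrix X X A))
    (hV : V ∈ unitary (Matrix Y Y A)) (h : T * U = V * T) : U * Tᴴ = Tᴴ * V :=
  calc U * Tᴴ = U * (Tᴴ * Vᴴ) * V := by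
        rw [Matrix.mul_assoc, Matrix.mul_assoc, ← Matrix.star_eq_conjTranspose V, hV.1,
          Matrix.mul_one]
    _ = U * (Uᴴ * Tᴴ) * V := by
        rw [← Matrix.conjTranspose_mul, ← h, Matrix.conjTranspose_mul]
    _ = Tᴴ * V := by
        rw [← Matrix.mul_assoc, ← Matrix.star_eq_conjTranspose U, hU.2, Matrix.one_mul]

theorem exists_common_constant [Fintype ι] [Ring A] [StarRing A] (K : Type*) [Field K]
    [CharZero K] [Algebra K A] {C : ι → Set X} {D : ι → Set Y} (hC : IsUniformFamily C)
    (hD : IsUniformFamily D) {U : Matrix X X A} {V : Matrix Y Y A}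
    (hU : U ∈ unitary (Matrix X X A)) (hV : V ∈ unitary (Matrix Y Y A))
    (h : classIndicator A D * (classIndicator A C)ᵀ * U =
      V * (classIndicator A D * (classIndicator A C)ᵀ)) :
    ∃ c : Matrix ι ι A, (classIndicator A C)ᵀ * U = c * (classIndicator A C)ᵀ ∧
      (classIndicator A D)ᵀ * V = c * (classIndicator A D)ᵀ ∧
      U * classIndicator A C = classIndicator A C * c ∧
      V * classIndicator A D = classIndicator A D * c := by
  classical
  obtain ⟨r, hr, hE⟩ := hC.exists_transpose_mul_self_eq_smul (A := A) K
  obtain ⟨s, hs, hF⟩ := hD.exists_transpose_mul_self_eq_smul (A := A) K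
  refine exists_common_compression K hr hs hE hF h ?_
  simpa only [Matrix.conjTranspose_mul, ← conjTranspose_classIndicator,
    Matrix.conjTranspose_conjTranspose] using mul_conjTranspose_eq_of_intertwines hU hV h

end Intertwiner

/-! ### Labelings with prescribed values on some blocks -/

section LabelingClass

variable {X Q L : Type*} {q : X → Q} {S : Set Q}

/-- The labelings of the points of `X` that are constant on the blocks, i.e. the fibres of `q`, and
have the values given by `i` on the blocks in `S`. -/
def labelingClass (q : X → Q) (S : Set Q) (i : S → L) : Set (X → L) :=
  {t | (∀ a b, q a = q b → t a = t b) ∧ ∀ a (b : S), q a = b → t a = i b}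

open scoped Classical in
/-- Change the labels of the blocks in `S` to those given by `i`. -/
def relabel (q : X → Q) (S : Set Q) (i : S → L) (t : X → L) : X → L :=
  fun a => if h : q a ∈ S then i ⟨q a, h⟩ else t a

theorem relabel_mem_labelingClass (i : S → L) {t : X → L} (ht : ∀ a b, q a = q b → t a = t b) :
    relabel q S i t ∈ labelingClass q S i := by
  refine ⟨fun a b hab => ?_, fun a b hab => ?_⟩
  · unfold relabel
    rw [ht a b hab]
    split_ifs with ha hb hb
    · exact congrArg i (Subtype.ext hab)
    · exact (hb (hab ▸ ha)).elim
    · exact (ha (hab ▸ hb)).elim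
    · rfl
  · simp only [relabel, hab, b.2, dif_pos]

theorem relabel_injOn (i j : S → L) : Set.InjOn (relabel q S j) (labelingClass q S i) := by
  intro t ht s hs hts
  funext a
  by_cases ha : q a ∈ S
  · rw [ht.2 a ⟨q a, ha⟩ rfl, hs.2 a ⟨q a, ha⟩ rfl]
  · simpa only [relabel, ha, dif_neg, not_false_eq_true] using congrFun hts a

theorem ncard_labelingClass_le [Finite X] [Finite L] (i j : S → L) :
    (labelingClass q S i).ncard ≤ (labelingClass q S j).ncard :=
  Set.ncard_le_ncard_of_injOn (relabel q S j) (fun _ ht => relabel_mem_labelingClass j ht.1)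
    (relabel_injOn i j) (Set.toFinite _)

theorem disjoint_labelingClass (hS : S ⊆ Set.range q) :
    Pairwise (Disjoint on (labelingClass q S : (S → L) → Set (X → L))) := by
  refine fun i j hij => Set.disjoint_left.2 fun t hi hj => hij (funext fun b => ?_)
  obtain ⟨a, ha⟩ := hS b.2
  rw [← hi.2 a b ha, hj.2 a b ha]

theorem isUniformFamily_labelingClass [Finite X] [Finite L] [Nonempty L] (hS : S ⊆ Set.range q) :
    IsUniformFamily (labelingClass q S : (S → L) → Set (X → L)) where
  nonempty i := ⟨_, relabel_mem_labelingClass i (t := fun _ => Classical.arbitrary L)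
    fun _ _ _ => rfl⟩
  disjoint := disjoint_labelingClass hS
  ncard_eq i j := (ncard_labelingClass_le i j).antisymm (ncard_labelingClass_le j i)

theorem mem_iUnion_labelingClass (hS : S ⊆ Set.range q) {t : X → L} :
    t ∈ ⋃ i, labelingClass q S i ↔ ∀ a b, q a = q b → t a = t b := by
  refine ⟨fun h => ?_, fun ht => ?_⟩
  · obtain ⟨i, hi⟩ := Set.mem_iUnion.1 h
    exact hi.1
  · choose f hf using hS
    exact Set.mem_iUnion.2
      ⟨fun b => t (f b.2), ht, fun a b hab => ht _ _ (hab.trans (hf b.2).symm)⟩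

end LabelingClass

namespace TwoColouredPartition

variable (p : TwoColouredPartition) {N d : ℕ}

instance : Finite p.ThroughBlock :=
  Subtype.finite

instance : Fintype p.ThroughBlock :=
  Fintype.ofFinite _

instance : DecidableEq p.ThroughBlock :=
  Classical.decEq _

/-- The block of an upper point. -/
def upperBlock (a : Fin p.k) : Quotient p.blocks :=
  Quotient.mk p.blocks (Sum.inl a)

/-- The block of a lower point. -/
def lowerBlock (a : Fin p.l) : Quotient p.blocks :=
  Quotient.mk p.blocks (Sum.inr a)

/-- The set of the through-blocks; `ThroughBlock` is its type of elements. -/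
def throughBlocks : Set (Quotient p.blocks) :=
  Set.range p.upperBlock ∩ Set.range p.lowerBlock

variable {p}

theorem upperValid_iff {t : Fin p.k → Fin N} :
    p.UpperValid t ↔ ∀ a b, p.upperBlock a = p.upperBlock b → t a = t b :=
  forall₂_congr fun _ _ => imp_congr_left Quotient.eq.symm

theorem lowerValid_iff {t : Fin p.l → Fin N} :
    p.LowerValid t ↔ ∀ a b, p.lowerBlock a = p.lowerBlock b → t a = t b :=
  forall₂_congr fun _ _ => imp_congr_left Quotient.eq.symm

variable (p)

theorem upperClass_eq_labelingClass :
    (p.upperClass : _ → Set (Fin p.k → Fin N)) = labelingClass p.upperBlock p.throughBlocks :=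
  funext fun _ => Set.ext fun _ => and_congr_left' upperValid_iff

theorem lowerClass_eq_labelingClass :
    (p.lowerClass : _ → Set (Fin p.l → Fin N)) = labelingClass p.lowerBlock p.throughBlocks :=
  funext fun _ => Set.ext fun _ => and_congr_left' lowerValid_iff

theorem isUniformFamily_upperClass [NeZero N] :
    IsUniformFamily (p.upperClass : _ → Set (Fin p.k → Fin N)) :=
  p.upperClass_eq_labelingClass ▸ isUniformFamily_labelingClass Set.inter_subset_left

theorem isUniformFamily_lowerClass [NeZero N] :
    IsUniformFamily (p.lowerClass : _ → Set (Fin p.l → Fin N)) :=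
  p.lowerClass_eq_labelingClass ▸ isUniformFamily_labelingClass Set.inter_subset_right

theorem upperInvalid_eq_compl : p.upperInvalid N = (⋃ i, p.upperClass i)ᶜ := by
  ext t
  rw [upperClass_eq_labelingClass, Set.mem_compl_iff]
  exact (upperValid_iff.trans (mem_iUnion_labelingClass Set.inter_subset_left).symm).not

theorem lowerInvalid_eq_compl : p.lowerInvalid N = (⋃ i, p.lowerClass i)ᶜ := by
  ext t
  rw [lowerClass_eq_labelingClass, Set.mem_compl_iff]
  exact (lowerValid_iff.trans (mem_iUnion_labelingClass Set.inter_subset_right).symm).not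

/-! ### The relations of a partition in matrix form -/

variable {A B : Type*}

/-- The 0-1 matrix whose columns indicate the sets `T_i`. -/
def upperIndicator (A : Type*) [Zero A] [One A] (N : ℕ) :
    Matrix (Fin p.k → Fin N) (p.ThroughBlock → Fin N) A :=
  classIndicator A p.upperClass

/-- The 0-1 matrix whose columns indicate the sets `T'_i`. -/
def lowerIndicator (A : Type*) [Zero A] [One A] (N : ℕ) :
    Matrix (Fin p.l → Fin N) (p.ThroughBlock → Fin N) A :=
  classIndicator A p.lowerClass

section Ring

variable [Ring A] [StarRing A] [Ring B] [StarRing B]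

/-- The 0-1 matrix that relates the labelings `T_i` and `T'_i` for every `i`. It is the linear map
that is usually associated with the partition `p`. -/
def intertwiner (A : Type*) [Ring A] (N : ℕ) : Matrix (Fin p.l → Fin N) (Fin p.k → Fin N) A :=
  p.lowerIndicator A N * (p.upperIndicator A N)ᵀ

/-- The matrix form of the relations `R^{Gr}_p(u)`. -/
def Intertwines (u : Matrix (Fin N) (Fin N) A) : Prop :=
  p.intertwiner A N * wordMatrix p.upperColour u = wordMatrix p.lowerColour u * p.intertwiner A N

/-- The conditions that the relations `R^{Sp}_p` impose on the matrices `M`, `M'` of the sums over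
the sets `T_i`, `T'_i`: the entries depend only on the class of the column index, which is the same
function of the class for `M` and `M'`, and the columns of invalid labelings are zero. -/
structure RespectsClasses (hd : d ≤ N) (M : Matrix (p.ThroughBlock → Fin N) (Fin p.k → Fin d) A)
    (M' : Matrix (p.ThroughBlock → Fin N) (Fin p.l → Fin d) A) : Prop where
  eq : ∀ i j γ γ', Fin.castLE hd ∘ γ ∈ p.upperClass j → Fin.castLE hd ∘ γ' ∈ p.lowerClass j →
    M i γ = M' i γ'
  upper : ∀ i γ, Fin.castLE hd ∘ γ ∈ p.upperInvalid N → M i γ = 0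
  lower : ∀ i γ', Fin.castLE hd ∘ γ' ∈ p.lowerInvalid N → M' i γ' = 0

/-- The matrix form of the relations `R^{Sp}_p(x)`. -/
def SpaceRelated (hd : d ≤ N) (x : Matrix (Fin N) (Fin d) A) : Prop :=
  p.RespectsClasses hd ((p.upperIndicator A N)ᵀ * wordMatrix p.upperColour x)
    ((p.lowerIndicator A N)ᵀ * wordMatrix p.lowerColour x)

variable {p}
variable {F : Type*} [FunLike F A B] [RingHomClass F A B] [StarHomClass F A B]

theorem map_upperSum (φ : F) (x : Matrix (Fin N) (Fin d) A) (i : p.ThroughBlock → Fin N)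
    (γ : Fin p.k → Fin d) :
    φ (p.upperSum x i γ) = ((p.upperIndicator B N)ᵀ * wordMatrix p.upperColour (x.map φ)) i γ := by
  rw [upperIndicator, classIndicator_transpose_mul_apply, wordMatrix_map]
  exact map_sum φ _ _

theorem map_lowerSum (φ : F) (x : Matrix (Fin N) (Fin d) A) (i : p.ThroughBlock → Fin N)
    (γ : Fin p.l → Fin d) :
    φ (p.lowerSum x i γ) = ((p.lowerIndicator B N)ᵀ * wordMatrix p.lowerColour (x.map φ)) i γ := by
  rw [lowerIndicator, classIndicator_transpose_mul_apply, wordMatrix_map]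
  exact map_sum φ _ _

theorem map_lowerSum_transpose (φ : F) (u : Matrix (Fin N) (Fin N) A) (i : p.ThroughBlock → Fin N)
    (γ : Fin p.l → Fin N) :
    φ (p.lowerSum uᵀ i γ) = (wordMatrix p.lowerColour (u.map φ) * p.lowerIndicator B N) γ i := by
  rw [map_lowerSum, Matrix.transpose_map, wordMatrix_transpose, lowerIndicator,
    ← transpose_mul_classIndicator, Matrix.transpose_apply]

theorem map_groupRelations_eq_zero_iff [NeZero N] (φ : F) (u : Matrix (Fin N) (Fin N) A) :
    (∀ r ∈ p.groupRelations u, φ r = 0) ↔ p.Intertwines (u.map φ) := by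
  rw [Intertwines, intertwiner, Matrix.mul_assoc (p.lowerIndicator B N),
    ← Matrix.mul_assoc (wordMatrix _ _)]
  refine Iff.trans ?_ (classIndicator_mul_eq_mul_transpose_iff p.isUniformFamily_upperClass
    p.isUniformFamily_lowerClass ((p.upperIndicator B N)ᵀ * wordMatrix p.upperColour (u.map φ))
    (wordMatrix p.lowerColour (u.map φ) * p.lowerIndicator B N)).symm
  simp only [← map_upperSum, ← map_lowerSum_transpose, ← Set.mem_compl_iff,
    ← upperInvalid_eq_compl, ← lowerInvalid_eq_compl]
  constructor
  · refine fun h => ⟨fun i j γ hγ γ' hγ' => ?_, fun i γ hγ => ?_, fun j γ' hγ' => ?_⟩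
    · exact sub_eq_zero.1 <| (map_sub φ _ _).symm.trans <|
        h _ (Or.inl (Or.inl ⟨i, j, γ, hγ, γ', hγ', rfl⟩))
    · exact h _ (Or.inl (Or.inr ⟨i, γ, hγ, rfl⟩))
    · exact h _ (Or.inr ⟨j, γ', hγ', rfl⟩)
  · rintro ⟨hclass, hupper, hlower⟩ _ ((⟨i, j, γ, hγ, γ', hγ', rfl⟩ | ⟨i, γ, hγ, rfl⟩) |
      ⟨j, γ', hγ', rfl⟩)
    · exact (map_sub φ _ _).trans (sub_eq_zero.2 (hclass i j γ hγ γ' hγ'))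
    · exact hupper i γ hγ
    · exact hlower j γ' hγ'

theorem map_spaceRelations_eq_zero_iff (hd : d ≤ N) (φ : F) (x : Matrix (Fin N) (Fin d) A) :
    (∀ r ∈ p.spaceRelations hd x, φ r = 0) ↔ p.SpaceRelated hd (x.map φ) := by
  constructor
  · refine fun h => ⟨fun i j γ γ' hγ hγ' => ?_, fun i γ hγ => ?_, fun i γ' hγ' => ?_⟩
    · rw [← map_upperSum, ← map_lowerSum, ← sub_eq_zero, ← map_sub]
      exact h _ (Or.inl (Or.inl ⟨i, j, γ, γ', hγ, hγ', rfl⟩))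
    · rw [← map_upperSum]
      exact h _ (Or.inl (Or.inr ⟨i, γ, hγ, rfl⟩))
    · rw [← map_lowerSum]
      exact h _ (Or.inr ⟨i, γ', hγ', rfl⟩)
  · rintro h _ ((⟨i, j, γ, γ', hγ, hγ', rfl⟩ | ⟨i, γ, hγ, rfl⟩) | ⟨i, γ', hγ', rfl⟩)
    · rw [map_sub, map_upperSum, map_lowerSum, sub_eq_zero]
      exact h.eq i j γ γ' hγ hγ'
    · rw [map_upperSum]
      exact h.upper i γ hγ
    · rw [map_lowerSum]
      exact h.lower i γ' hγ'

end Ring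

end TwoColouredPartition

namespace TwoColouredPartition

section Products

variable {p : TwoColouredPartition} {N d : ℕ} {A : Type*} [Ring A]

theorem RespectsClasses.mul_left {hd : d ≤ N}
    {M : Matrix (p.ThroughBlock → Fin N) (Fin p.k → Fin d) A}
    {M' : Matrix (p.ThroughBlock → Fin N) (Fin p.l → Fin d) A} (h : p.RespectsClasses hd M M')
    (c : Matrix (p.ThroughBlock → Fin N) (p.ThroughBlock → Fin N) A) :
    p.RespectsClasses hd (c * M) (c * M') where
  eq i j γ γ' hγ hγ' := Finset.sum_congr rfl fun s _ => congrArg (c i s * ·) (h.eq s j γ γ' hγ hγ')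
  upper i γ hγ := Finset.sum_eq_zero fun s _ => (h.upper s γ hγ).symm ▸ mul_zero (c i s)
  lower i γ' hγ' := Finset.sum_eq_zero fun s _ => (h.lower s γ' hγ').symm ▸ mul_zero (c i s)

variable [StarRing A]

theorem Intertwines.mul {u v : Matrix (Fin N) (Fin N) A} (hu : p.Intertwines u)
    (hv : p.Intertwines v) (huv : EntriesStarCommute u v) : p.Intertwines (u * v) := by
  rw [Intertwines, wordMatrix_mul huv, wordMatrix_mul huv, ← Matrix.mul_assoc, hu,
    Matrix.mul_assoc, hv, Matrix.mul_assoc]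

variable (p) in
/-- The sums over `T_i` of the words in the entries of `a` are constant on the classes `T_j`, those
over `T'_i` are constant on the classes `T'_j`, and both have the same values `c i j`. -/
structure IsClassMatrix (a : Matrix (Fin N) (Fin N) A)
    (c : Matrix (p.ThroughBlock → Fin N) (p.ThroughBlock → Fin N) A) : Prop where
  upper : (p.upperIndicator A N)ᵀ * wordMatrix p.upperColour a = c * (p.upperIndicator A N)ᵀ
  lower : (p.lowerIndicator A N)ᵀ * wordMatrix p.lowerColour a = c * (p.lowerIndicator A N)ᵀ

theorem IsClassMatrix.spaceRelated_mul {hd : d ≤ N} {a : Matrix (Fin N) (Fin N) A}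
    {c : Matrix (p.ThroughBlock → Fin N) (p.ThroughBlock → Fin N) A} {x : Matrix (Fin N) (Fin d) A}
    (hc : p.IsClassMatrix a c) (hx : p.SpaceRelated hd x) (hax : EntriesStarCommute a x) :
    p.SpaceRelated hd (a * x) := by
  rw [SpaceRelated, wordMatrix_mul hax, wordMatrix_mul hax, ← Matrix.mul_assoc, hc.upper,
    ← Matrix.mul_assoc, hc.lower, Matrix.mul_assoc, Matrix.mul_assoc]
  exact RespectsClasses.mul_left hx c

theorem Intertwines.exists_isClassMatrix [NeZero N] (K : Type*) [Field K] [CharZero K]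
    [Algebra K A] {u : Matrix (Fin N) (Fin N) A} (h : p.Intertwines u)
    (hu : ∀ c : Colour, u.map c.pow ∈ unitary (Matrix (Fin N) (Fin N) A)) :
    ∃ c : Matrix (p.ThroughBlock → Fin N) (p.ThroughBlock → Fin N) A,
      p.IsClassMatrix u c ∧ p.IsClassMatrix uᵀ cᵀ := by
  obtain ⟨c, hupper, hlower, hupper', hlower'⟩ := exists_common_constant K
    p.isUniformFamily_upperClass p.isUniformFamily_lowerClass (wordMatrix_mem_unitary hu _)
    (wordMatrix_mem_unitary hu _) h
  refine ⟨c, ⟨hupper, hlower⟩, ?_, ?_⟩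
  · rw [wordMatrix_transpose, upperIndicator, ← transpose_mul_classIndicator, hupper',
      transpose_classIndicator_mul]
  · rw [wordMatrix_transpose, lowerIndicator, ← transpose_mul_classIndicator, hlower',
      transpose_classIndicator_mul]

end Products

/-! ### The mixed-coloured pair partitions -/

section Pairs

instance (c₁ c₂ : Colour) : IsEmpty (upperPair c₁ c₂).ThroughBlock :=
  ⟨fun b => Fin.elim0 b.2.2.choose⟩

variable {c₁ c₂ : Colour} {N : ℕ} {A : Type*}

theorem forall_fin_two_eq_iff {L : Type*} {t : Fin 2 → L} :
    (∀ a b : Fin 2, t a = t b) ↔ t 0 = t 1 := by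
  simp only [Fin.forall_fin_two, true_and, and_true, eq_comm (a := t 1), and_self]

theorem mem_lowerClass_lowerPair (i : (lowerPair c₁ c₂).ThroughBlock → Fin N)
    (t : Fin 2 → Fin N) : t ∈ (lowerPair c₁ c₂).lowerClass i ↔ t 0 = t 1 :=
  ⟨fun ht => ht.1 (0 : Fin 2) (1 : Fin 2) trivial,
    fun ht => ⟨fun a b _ => forall_fin_two_eq_iff.2 ht a b, fun _ b => isEmptyElim b⟩⟩

theorem mem_upperClass_upperPair (i : (upperPair c₁ c₂).ThroughBlock → Fin N)
    (t : Fin 2 → Fin N) : t ∈ (upperPair c₁ c₂).upperClass i ↔ t 0 = t 1 :=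
  ⟨fun ht => ht.1 (0 : Fin 2) (1 : Fin 2) trivial,
    fun ht => ⟨fun a b _ => forall_fin_two_eq_iff.2 ht a b, fun _ b => isEmptyElim b⟩⟩

theorem mem_lowerClass_upperPair (i : (upperPair c₁ c₂).ThroughBlock → Fin N)
    (t : Fin 0 → Fin N) : t ∈ (upperPair c₁ c₂).lowerClass i :=
  ⟨fun a => Fin.elim0 a, fun a => Fin.elim0 a⟩

/-- The vector `∑ r, e_r ⊗ e_r` as a matrix with a single column. -/
def pairVector (A : Type*) [Zero A] [One A] (N : ℕ) : Matrix (Fin 2 → Fin N) (Fin 0 → Fin N) A :=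
  classIndicator A fun _ => {t | t 0 = t 1}

theorem pairVector_apply [Zero A] [One A] (t : Fin 2 → Fin N) (s : Fin 0 → Fin N) :
    pairVector A N t s = if t 0 = t 1 then 1 else 0 :=
  Set.indicator_apply _ _ _

variable [Ring A]

theorem lowerPair_intertwiner : (lowerPair c₁ c₂).intertwiner A N = pairVector A N := by
  ext (t : Fin 2 → Fin N) (s : Fin 0 → Fin N)
  have hs : s ∈ (lowerPair c₁ c₂).upperClass isEmptyElim := mem_upperClass_lowerPair _ s
  refine (mul_classIndicator_transpose_apply_of_mem
    (fun _ _ h => (h (Subsingleton.elim _ _)).elim) hs _ t).trans ?_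
  rw [pairVector_apply]
  split_ifs with ht
  · exact classIndicator_apply_of_mem ((mem_lowerClass_lowerPair _ t).2 ht)
  · exact classIndicator_apply_of_notMem ((mem_lowerClass_lowerPair _ t).not.2 ht)

theorem upperPair_intertwiner : (upperPair c₁ c₂).intertwiner A N = (pairVector A N)ᵀ := by
  ext (t : Fin 0 → Fin N) (s : Fin 2 → Fin N)
  have ht : t ∈ (upperPair c₁ c₂).lowerClass isEmptyElim := mem_lowerClass_upperPair _ t
  refine (classIndicator_mul_apply_of_mem
    (fun _ _ h => (h (Subsingleton.elim _ _)).elim) ht _ s).trans ?_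
  rw [Matrix.transpose_apply, pairVector_apply]
  split_ifs with hs
  · exact classIndicator_apply_of_mem ((mem_upperClass_upperPair _ s).2 hs)
  · exact classIndicator_apply_of_notMem ((mem_upperClass_upperPair _ s).not.2 hs)

variable [StarRing A] {u : Matrix (Fin N) (Fin N) A}

theorem wordMatrix_mul_pairVector_apply (ω : Fin 2 → Colour) (t : Fin 2 → Fin N)
    (s : Fin 0 → Fin N) :
    (wordMatrix ω u * pairVector A N) t s = (u.map (ω 0).pow * (u.map (ω 1).pow)ᵀ) (t 0) (t 1) := by
  have hword (r : Fin 2 → Fin N) :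
      wordMatrix ω u t r = (ω 0).pow (u (t 0) (r 0)) * (ω 1).pow (u (t 1) (r 1)) := by
    rw [wordMatrix_apply, List.ofFn_succ, List.ofFn_succ, List.ofFn_zero, List.prod_cons,
      List.prod_singleton]
    rfl
  simp only [Matrix.mul_apply, hword, pairVector_apply, mul_ite, mul_one, mul_zero]
  rw [← (finTwoArrowEquiv (Fin N)).symm.sum_comp, Fintype.sum_prod_type]
  simp only [finTwoArrowEquiv_symm_apply, Matrix.cons_val_zero, Matrix.cons_val_one,
    Finset.sum_ite_eq, Finset.mem_univ, if_true, Matrix.map_apply, Matrix.transpose_apply]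

theorem Intertwines.map_pow_mul_transpose (h : (lowerPair c₁ c₂).Intertwines u) :
    u.map c₁.pow * (u.map c₂.pow)ᵀ = 1 := by
  have hone : wordMatrix (lowerPair c₁ c₂).upperColour u = 1 := wordMatrix_fin_zero _ u
  rw [Intertwines, hone, Matrix.mul_one, lowerPair_intertwiner] at h
  ext i j
  exact (wordMatrix_mul_pairVector_apply ![c₁, c₂] ![i, j] ![]).symm.trans <|
    (congrFun₂ h.symm ![i, j] ![]).trans (pairVector_apply _ _)

theorem Intertwines.transpose_map_pow_mul (h : (upperPair c₁ c₂).Intertwines u) :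
    (u.map c₁.pow)ᵀ * u.map c₂.pow = 1 := by
  have hone : wordMatrix (upperPair c₁ c₂).lowerColour u = 1 := wordMatrix_fin_zero _ u
  rw [Intertwines, hone, Matrix.one_mul, upperPair_intertwiner] at h
  have htranspose : wordMatrix ![c₁, c₂] uᵀ * pairVector A N = pairVector A N := by
    rw [← Matrix.transpose_inj, pairVector, transpose_mul_classIndicator]
    exact h
  ext i j
  exact (wordMatrix_mul_pairVector_apply ![c₁, c₂] ![i, j] ![]).symm.trans <|
    (congrFun₂ htranspose ![i, j] ![]).trans (pairVector_apply _ _)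

theorem lowerPair_flip_mem_mixedPairs (c : Colour) : lowerPair c c.flip ∈ mixedPairs := by
  cases c
  · exact Or.inl rfl
  · exact Or.inr (Or.inl rfl)

theorem upperPair_flip_mem_mixedPairs (c : Colour) : upperPair c.flip c ∈ mixedPairs := by
  cases c
  · exact Or.inr (Or.inr (Or.inr rfl))
  · exact Or.inr (Or.inr (Or.inl rfl))

theorem map_pow_mem_unitary (h : ∀ p ∈ mixedPairs, p.Intertwines u) (c : Colour) :
    u.map c.pow ∈ unitary (Matrix (Fin N) (Fin N) A) := by
  have hstar : star (u.map c.pow) = (u.map c.flip.pow)ᵀ :=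
    Matrix.ext fun i j => (Colour.flip_pow c (u j i)).symm
  rw [Unitary.mem_iff, hstar]
  exact ⟨(h _ (upperPair_flip_mem_mixedPairs c)).transpose_map_pow_mul,
    (h _ (lowerPair_flip_mem_mixedPairs c)).map_pow_mul_transpose⟩

end Pairs

end TwoColouredPartition

open TwoColouredPartition

section EntriesStarCommute

variable {k l m n : Type*} {A B D : Type*} [Semiring D] [StarRing D]

theorem EntriesStarCommute.transpose_left {a : Matrix k l D} {b : Matrix m n D}
    (h : EntriesStarCommute a b) : EntriesStarCommute aᵀ b :=
  fun i j => h j i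

theorem entriesStarCommute_map {F G : Type*} [Star A] [Star B] [FunLike F A D] [StarHomClass F A D]
    [FunLike G B D] [StarHomClass G B D] {f : F} {g : G} (h : ∀ a b, Commute (f a) (g b))
    (a : Matrix k l A) (b : Matrix m n B) : EntriesStarCommute (a.map f) (b.map g) :=
  fun i j i' j' c c' => by
    rw [Matrix.map_apply, Matrix.map_apply, ← Colour.map_pow, ← Colour.map_pow]
    exact h _ _

end EntriesStarCommute

variable {N d : ℕ} {P : Set TwoColouredPartition} {hP : mixedPairs ⊆ P}

/-! ### Homomorphisms out of `C(G_N(P))` and `C(X_{N,d}(P))` -/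

namespace EasyQuantumGroup

variable {D : Type*} [NeZero N]

theorem intertwines_map [Ring D] [StarRing D] [Algebra ℂ D] (φ : EasyQuantumGroup N P hP →⋆ₐ[ℂ] D)
    {p : TwoColouredPartition} (hp : p ∈ P) : p.Intertwines ((u N P hP).map φ) :=
  (map_groupRelations_eq_zero_iff (φ.comp (UniversalCStarAlgebra.ofFree _ _)) (freeMatrix N N)).1
    fun _ hr => (congrArg φ (UniversalCStarAlgebra.ofFree_eq_zero _ _
      (Set.mem_biUnion hp hr))).trans (map_zero φ)

theorem exists_hom [CStarAlgebra D] {v : Matrix (Fin N) (Fin N) D}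
    (hv : ∀ p ∈ P, p.Intertwines v) :
    ∃ φ : EasyQuantumGroup N P hP →⋆ₐ[ℂ] D, (u N P hP).map φ = v := by
  have heval : (freeMatrix N N).map (FreeStarAlgebra.eval fun ij => v ij.1 ij.2) = v :=
    Matrix.ext fun i j => FreeStarAlgebra.eval_gen _ (i, j)
  obtain ⟨φ, hφ⟩ := UniversalCStarAlgebra.exists_lift (easyRelations N P)
    (universalExists_easyRelations N hP) (fun ij => v ij.1 ij.2) fun r hr => by
      obtain ⟨p, hp, hr⟩ := Set.mem_iUnion₂.1 hr
      exact (map_groupRelations_eq_zero_iff _ _).2 (heval.symm ▸ hv p hp) r hr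
  exact ⟨φ, Matrix.ext fun i j => hφ (i, j)⟩

end EasyQuantumGroup

namespace PartitionQuantumSpace

variable {D : Type*} {hd : d ≤ N}

theorem spaceRelated_map [Ring D] [StarRing D] [Algebra ℂ D]
    (φ : PartitionQuantumSpace hd P hP →⋆ₐ[ℂ] D) {p : TwoColouredPartition} (hp : p ∈ P) :
    p.SpaceRelated hd ((x hd P hP).map φ) :=
  (map_spaceRelations_eq_zero_iff hd (φ.comp (UniversalCStarAlgebra.ofFree _ _))
    (freeMatrix N d)).1 fun _ hr => (congrArg φ (UniversalCStarAlgebra.ofFree_eq_zero _ _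
      (Set.mem_biUnion hp hr))).trans (map_zero φ)

theorem existsUnique_hom [CStarAlgebra D] {y : Matrix (Fin N) (Fin d) D}
    (hy : ∀ p ∈ P, p.SpaceRelated hd y) :
    ∃! φ : PartitionQuantumSpace hd P hP →⋆ₐ[ℂ] D, (x hd P hP).map φ = y := by
  have heval : (freeMatrix N d).map (FreeStarAlgebra.eval fun ij => y ij.1 ij.2) = y :=
    Matrix.ext fun i j => FreeStarAlgebra.eval_gen _ (i, j)
  obtain ⟨φ, hφ⟩ := UniversalCStarAlgebra.exists_lift (pqsRelations hd P)
    (universalExists_pqsRelations hd hP) (fun ij => y ij.1 ij.2) fun r hr => by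
      obtain ⟨p, hp, hr⟩ := Set.mem_iUnion₂.1 hr
      exact (map_spaceRelations_eq_zero_iff hd _ _).2 (heval.symm ▸ hy p hp) r hr
  refine ⟨φ, Matrix.ext fun i j => hφ (i, j), fun ψ hψ => ?_⟩
  exact UniversalCStarAlgebra.hom_ext _ _ fun ij =>
    (congrFun₂ hψ ij.1 ij.2).trans (hφ ij).symm

theorem existsUnique_map_eq_mul [CStarAlgebra D] {a : Matrix (Fin N) (Fin N) D}
    (ha : ∀ p ∈ P, ∃ c, p.IsClassMatrix a c) {ρ : PartitionQuantumSpace hd P hP →⋆ₐ[ℂ] D}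
    (hcomm : EntriesStarCommute a ((x hd P hP).map ρ)) :
    ∃! α : PartitionQuantumSpace hd P hP →⋆ₐ[ℂ] D, (x hd P hP).map α = a * (x hd P hP).map ρ :=
  existsUnique_hom fun p hp =>
    let ⟨_, hc⟩ := ha p hp
    hc.spaceRelated_mul (spaceRelated_map ρ hp) hcomm

theorem generatesCStar_x : GeneratesCStar (x hd P hP) :=
  UniversalCStarAlgebra.topologicalClosure_adjoin_gen _ _

end PartitionQuantumSpace

/-! ### The comultiplication and the matrix-vector actions -/

section MatrixVectorAction

variable {A B : Type*} [CStarAlgebra A] [CStarAlgebra B] {u : Matrix (Fin N) (Fin N) A}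
  {x : Matrix (Fin N) (Fin d) B} {α : B →⋆ₐ[ℂ] MinTensor A B}

open MinTensor

theorem map_inLeft_mul_map_inRight_apply {m : ℕ} (a : Matrix (Fin m) (Fin N) A)
    (x : Matrix (Fin N) (Fin d) B) (i : Fin m) (j : Fin d) :
    (a.map (inLeft A B) * x.map (inRight A B)) i j = ∑ k, tmul (a i k) (x k j) := by
  simp only [Matrix.mul_apply, Matrix.map_apply, inLeft_mul_inRight]

theorem isLeftMatrixVectorAction_iff :
    IsLeftMatrixVectorAction u x α ↔ x.map α = u.map (inLeft A B) * x.map (inRight A B) := by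
  simp only [IsLeftMatrixVectorAction, ← Matrix.ext_iff, map_inLeft_mul_map_inRight_apply,
    Matrix.map_apply]

theorem isRightMatrixVectorAction_iff :
    IsRightMatrixVectorAction u x α ↔ x.map α = (u.map (inLeft A B))ᵀ * x.map (inRight A B) := by
  simp only [IsRightMatrixVectorAction, ← Matrix.transpose_map, ← Matrix.ext_iff,
    map_inLeft_mul_map_inRight_apply, Matrix.map_apply, Matrix.transpose_apply]

end MatrixVectorAction

namespace EasyQuantumGroup

variable {D : Type*} [NeZero N]

theorem map_pow_mem_unitary [Ring D] [StarRing D] [Algebra ℂ D]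
    (φ : EasyQuantumGroup N P hP →⋆ₐ[ℂ] D) (c : Colour) :
    ((u N P hP).map φ).map c.pow ∈ unitary (Matrix (Fin N) (Fin N) D) :=
  TwoColouredPartition.map_pow_mem_unitary (fun _ hp => intertwines_map φ (hP hp)) c

theorem exists_isClassMatrix [Ring D] [StarRing D] [Algebra ℂ D]
    (φ : EasyQuantumGroup N P hP →⋆ₐ[ℂ] D) {p : TwoColouredPartition} (hp : p ∈ P) :
    ∃ c : Matrix (p.ThroughBlock → Fin N) (p.ThroughBlock → Fin N) D,
      p.IsClassMatrix ((u N P hP).map φ) c ∧ p.IsClassMatrix ((u N P hP).map φ)ᵀ cᵀ :=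
  (intertwines_map φ hp).exists_isClassMatrix ℂ (map_pow_mem_unitary φ)

theorem isUnit_map_pow (c : Colour) : IsUnit ((u N P hP).map c.pow) :=
  (Unitary.toUnits ⟨_, map_pow_mem_unitary (StarAlgHom.id ℂ (EasyQuantumGroup N P hP)) c⟩).isUnit

theorem isCompactMatrixQuantumGroup_u : IsCompactMatrixQuantumGroup (u N P hP) where
  generates := UniversalCStarAlgebra.topologicalClosure_adjoin_gen _ _
  isUnit := isUnit_map_pow .white
  isUnit_conj := isUnit_map_pow .black
  exists_comul := by
    obtain ⟨Δ, hΔ⟩ := exists_hom (hP := hP) fun p hp =>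
      (intertwines_map (MinTensor.inLeft _ _) hp).mul (intertwines_map (MinTensor.inRight _ _) hp)
        (entriesStarCommute_map MinTensor.commute_inLeft_inRight (u N P hP) (u N P hP))
    exact ⟨Δ, fun i j => (congrFun₂ hΔ i j).trans (map_inLeft_mul_map_inRight_apply _ _ i j)⟩

end EasyQuantumGroup

end

theorem mainTheorem2 (N d : ℕ) (hd1 : 1 ≤ d) (hd : d ≤ N) (P : Set TwoColouredPartition)
    (hP : TwoColouredPartition.mixedPairs ⊆ P) :
    IsCompactMatrixQuantumGroup (EasyQuantumGroup.u N P hP) ∧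
    GeneratesCStar (PartitionQuantumSpace.x hd P hP) ∧
    (∃! α : PartitionQuantumSpace hd P hP →⋆ₐ[ℂ]
        MinTensor (EasyQuantumGroup N P hP) (PartitionQuantumSpace hd P hP),
      IsLeftMatrixVectorAction (EasyQuantumGroup.u N P hP) (PartitionQuantumSpace.x hd P hP) α) ∧
    (∃! β : PartitionQuantumSpace hd P hP →⋆ₐ[ℂ]
        MinTensor (EasyQuantumGroup N P hP) (PartitionQuantumSpace hd P hP),
      IsRightMatrixVectorAction (EasyQuantumGroup.u N P hP) (PartitionQuantumSpace.x hd P hP) β) := by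
  have _ : NeZero N := .of_pos (hd1.trans hd)
  have hcomm := entriesStarCommute_map MinTensor.commute_inLeft_inRight (EasyQuantumGroup.u N P hP)
    (PartitionQuantumSpace.x hd P hP)
  have hclass (p) (hp : p ∈ P) := EasyQuantumGroup.exists_isClassMatrix (N := N) (hP := hP)
    (MinTensor.inLeft _ (PartitionQuantumSpace hd P hP)) hp
  simp only [isLeftMatrixVectorAction_iff, isRightMatrixVectorAction_iff]
  refine ⟨EasyQuantumGroup.isCompactMatrixQuantumGroup_u, PartitionQuantumSpace.generatesCStar_x,
    PartitionQuantumSpace.existsUnique_map_eq_mul (fun p hp => ?_) hcomm,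
    PartitionQuantumSpace.existsUnique_map_eq_mul (fun p hp => ?_) hcomm.transpose_left⟩
  · obtain ⟨c, hc, -⟩ := hclass p hp
    exact ⟨c, hc⟩
  · obtain ⟨c, -, hc⟩ := hclass p hp
    exact ⟨c.transpose, hc⟩
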